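/- Let $n\ge 3$ be an odd integer. For a reciprocal polynomial $f\in\mathbb{Z}[x]$ of degree $2n$ (that is, $x^{2n}f(1/x)=f(x)$), let $g\in\mathbb{Z}[u]$ be the unique polynomial of degree $n$ with $f(x)=x^n g(x+1/x)$. Let $G_f$ and $G_g$ be the Galois groups over $\mathbb{Q}$ of $f$ and $g$, regarded as permutation groups of their complex roots. If $f$ is separable, its $2n$ roots fall into $n$ pairs $\{\alpha_i,1/\alpha_i\}$, and $G_f$ is a subgroup, well defined up to conjugation, of the group $S_2\wr S_n=\mathbb{F}_2^n\rtimes S_n$ of permutations of the roots preserving this partition into pairs. Let $$G_3=\langle\mathbf{1}\rangle\times S_n=\{(\mathbf{v},\sigma)\in\mathbb{F}_2^n\rtimes S_n:\ \mathbf{v}=(0,\dots,0)\text{ or }\mathbf{v}=(1,\dots,1)\}.$$ For real $H\ge 2$ let $\mathcal{E}_n(G_3;H)$ be the number of separable reciprocal polynomials $f\in\mathbb{Z}[x]$ of degree $2n$ with all coefficients in $[-H,H]$ such that $G_g=S_n$ and $G_f$ is conjugate in $S_2\wr S_n$ to a subgroup of $G_3$, and let $\mathcal{E}_n^{\mathrm{monic}}(G_3;H)$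 be the number of those $f$ that are monic. Then, as $H\to\infty$, $$\mathcal{E}_n(G_3;H)\ll\begin{cases}H^2\log^2 H, & n=3,\\ H^{\frac{n+1}{2}}, & n\ge 5,\end{cases}\qquad \mathcal{E}_n^{\mathrm{monic}}(G_3;H)\ll\begin{cases}H^2, & n=3,\\ H^2\log H\,\log\log H, & n=5,\\ H^{\frac{n-1}{2}}\log H, & n\ge 7.\end{cases}$$ Here $A(H)\ll B(H)$ means that there is a constant $c$, depending only on $n$, with $|A(H)|\le c\,|B(H)|$ for all sufficiently large real $H$. -/

import Mathlib

open Polynomial Filter Asymptotics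

namespace ReciprocalGalois

noncomputable section

/-! ### The wreath product `S₂ ≀ Sₙ = 𝔽₂ⁿ ⋊ Sₙ` and its subgroup `G₃` -/

/-- The group with two elements, written multiplicatively; it plays the role of `𝔽₂ = S₂`. -/
abbrev S2 : Type := Multiplicative (ZMod 2)

/-- The nontrivial element of `S₂`. -/
def flip : S2 := Multiplicative.ofAdd 1

/-- The wreath product `S₂ ≀ Sₙ = 𝔽₂ⁿ ⋊ Sₙ`, where `Sₙ` permutes the `n` coordinates:
`(σ v) i = v (σ⁻¹ i)`. -/
abbrev Wreath (n : ℕ) : Type :=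
  (Fin n → S2) ⋊[(mulAutArrow : Equiv.Perm (Fin n) →* MulAut (Fin n → S2))] Equiv.Perm (Fin n)

/-- The subgroup `G₃ = ⟨𝟏⟩ × Sₙ` of `S₂ ≀ Sₙ`: the pairs `(v, σ)` with `v = (0, …, 0)` or
`v = (1, …, 1)`. -/
def G3 (n : ℕ) : Subgroup (Wreath n) where
  carrier := {w | ∃ c : S2, w.left = fun _ => c}
  one_mem' := ⟨1, rfl⟩
  mul_mem' := by
    rintro a b ⟨c, hc⟩ ⟨d, hd⟩
    refine ⟨c * d, ?_⟩
    funext i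
    simp only [SemidirectProduct.mul_left, hc, hd]
    rfl
  inv_mem' := by
    rintro a ⟨c, hc⟩
    refine ⟨c⁻¹, ?_⟩
    funext i
    simp only [SemidirectProduct.inv_left, hc]
    rfl

/-- The standard action of `S₂ ≀ Sₙ` on the `2n` points of `n` pairs:
`(v, σ)` sends `(i, s)` to `(σ i, v (σ i) * s)`. -/
def Wreath.act {n : ℕ} (w : Wreath n) (p : Fin n × S2) : Fin n × S2 :=
  (w.right p.1, w.left (w.right p.1) * p.2)

theorem Wreath.act_one {n : ℕ} (p : Fin n × S2) : (1 : Wreath n).act p = p := by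
  simp [Wreath.act]

theorem Wreath.act_mul {n : ℕ} (w w' : Wreath n) (p : Fin n × S2) :
    (w * w').act p = w.act (w'.act p) := by
  simp only [Wreath.act, SemidirectProduct.mul_right, SemidirectProduct.mul_left,
    Equiv.Perm.mul_apply, Pi.mul_apply, mul_assoc]
  change (_, w.left _ * (w'.left (w.right⁻¹ (w.right (w'.right p.1))) * p.2)) = _
  simp

/-! ### Reciprocal polynomials and their Galois groups -/

attribute [local instance] Polynomial.Gal.splits_ℚ_ℂ

/-- The polynomial `f`, viewed over `ℚ`. -/
abbrev toRat (f : ℤ[X]) : ℚ[X] := f.map (Int.castRingHom ℚ)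

/-- `f` is a reciprocal polynomial: `x ^ (deg f) * f (1 / x) = f x`, i.e. its list of
coefficients is palindromic. -/
def IsReciprocal (f : ℤ[X]) : Prop := f.reverse = f

/-- `g` is the degree `n` polynomial attached to the reciprocal polynomial `f` of degree `2n`:
`f x = x ^ n * g (x + 1 / x)`. -/
def IsTracePolynomial (n : ℕ) (f g : ℤ[X]) : Prop :=
  g.natDegree = n ∧ ∀ x : ℂ, x ≠ 0 → aeval x f = x ^ n * aeval (x + x⁻¹) g

/-- The Galois group of `g` over `ℚ` is the full symmetric group on the complex roots of `g`. -/
def HasFullSymmetricGalois (g : ℤ[X]) : Prop :=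
  Function.Surjective (Gal.galActionHom (toRat g) ℂ)

/-- A labelling of the roots of `f` as `n` pairs `{α i, 1 / α i}`: the point `(i, s)` labels
a root, and swapping `s` inverts that root. -/
structure RootLabelling (n : ℕ) (f : ℤ[X]) where
  /-- the bijection between labels and roots -/
  toEquiv : Fin n × S2 ≃ (toRat f).rootSet ℂ
  /-- the two members of a pair are inverse to each other -/
  flip_eq_inv : ∀ (i : Fin n) (s : S2),
    (toEquiv (i, flip * s) : ℂ) = (toEquiv (i, s) : ℂ)⁻¹

/-- `G_f ⊆ G` for a subgroup `G` of `S₂ ≀ Sₙ`, up to conjugation: for some labelling of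
the roots of `f` by pairs, every element of the Galois group of `f` over `ℚ` permutes the
roots as some element of `G` permutes the labels. (Changing the labelling amounts to
conjugating in `S₂ ≀ Sₙ`.) -/
def GaloisContainedIn {n : ℕ} (f : ℤ[X]) (G : Subgroup (Wreath n)) : Prop :=
  ∃ ε : RootLabelling n f, ∀ γ : (toRat f).Gal, ∃ w ∈ G, ∀ p : Fin n × S2,
    Gal.galActionHom (toRat f) ℂ γ (ε.toEquiv p) = ε.toEquiv (w.act p)

/-! ### The counting functions -/

/-- The separable reciprocal polynomials `f ∈ ℤ[x]` of degree `2n` with coefficients in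
`[-H, H]` such that `G_g = Sₙ` and `G_f ⊆ G`. -/
def exceptionalSet {n : ℕ} (G : Subgroup (Wreath n)) (H : ℝ) : Set ℤ[X] :=
  {f | f.natDegree = 2 * n ∧ IsReciprocal f ∧ (toRat f).Separable ∧
    (∀ i, |(f.coeff i : ℝ)| ≤ H) ∧
    (∃ g : ℤ[X], IsTracePolynomial n f g ∧ HasFullSymmetricGalois g) ∧
    GaloisContainedIn f G}

theorem exceptionalSet_finite {n : ℕ} (G : Subgroup (Wreath n)) (H : ℝ) :
    (exceptionalSet G H).Finite := by
  have hinj : Set.InjOn (fun (f : ℤ[X]) (i : Fin (2 * n + 1)) => f.coeff i)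
      (exceptionalSet G H) := by
    intro f hf f' hf' h
    ext i
    by_cases hi : i < 2 * n + 1
    · exact congrFun h ⟨i, hi⟩
    · rw [coeff_eq_zero_of_natDegree_lt (by rw [hf.1]; omega),
        coeff_eq_zero_of_natDegree_lt (by rw [hf'.1]; omega)]
  refine Set.Finite.of_finite_image (Set.Finite.subset
    (Set.Finite.pi' fun _ : Fin (2 * n + 1) => Set.finite_Icc (-⌊H⌋) ⌊H⌋) ?_) hinj
  rintro _ ⟨f, hf, rfl⟩ i
  have h := abs_le.1 (hf.2.2.2.1 i)
  refine ⟨?_, Int.le_floor.2 h.2⟩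
  have : -f.coeff i ≤ ⌊H⌋ := Int.le_floor.2 (by push_cast; linarith)
  change -⌊H⌋ ≤ f.coeff i
  linarith

/-- `𝓔ₙ(G; H)`. -/
def countE {n : ℕ} (G : Subgroup (Wreath n)) (H : ℝ) : ℕ :=
  (exceptionalSet G H).ncard

/-- `𝓔ₙ^monic(G; H)`. -/
def countEMonic {n : ℕ} (G : Subgroup (Wreath n)) (H : ℝ) : ℕ :=
  {f ∈ exceptionalSet G H | f.Monic}.ncard

end

end ReciprocalGalois

/-! Choose one root `x i` from each reciprocal pair and put h = ∏ (X - x i), k = ∏ (X - (x i)⁻¹), ω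
= ∏ (-x i). Containment in G₃ means that each Galois element either fixes h and k or swaps them.
Since h reflects to ωk, the polynomial h + ωk is palindromic and h - ωk antipalindromic. A swap
multiplies each of them by ±ω⁻¹, so their squares divided by ω are rational multiples of rational
squares. With 4ωhk = (h + ωk)² - (h - ωk)² this gives f = αA² - βB² over ℚ
(`exists_decomposition_of_gal`). For primitive integral A and B, reduction modulo odd primes and a
2-adic argument show that 4α and 4β are integers (`four_mul_eq_of_rat`), so 4f = aA² - bB².

The two squares cannot cancel everywhere: for ab > 0 their contributions add up on the unit circle,
for ab < 0 on the real line. Interpolation then bounds |a|A_i² and |b|B_i² by O(H)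
(`exists_coeff_sq_le`).

Let n = 2k+1. Each of A, B is determined by k+1 coefficients, so a pair (a, b) accounts for
O(H^(k+1) |ab|^(-(k+1)/2)) polynomials, and summing over a and b gives the general bound. If f is
monic, the leading coefficients satisfy as² - bt² = 4, and the count is O(H^k) times the sum of
|ab|^(-k/2) over such quadruples (a, b, s, t). Those with st = 0 or ab < 0 are treated directly. The
others are grouped by D = ab: u = as² - 2 and w = st solve u² - Dw² = 4, which has O(log H /
log(D+1)) solutions in range, each coming from at most 9 quadruples (`card_quadruple_le`). What
remains is log H times the sum of D^(-k/2) / log(D+1) over D ≪ H². -/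

namespace ReciprocalGalois

/-! ### From the Galois group to a rational decomposition -/

/-- A polynomial all of whose products of two coefficients lie, up to the common factor `ω`, in
the base field is, up to a scalar, a polynomial over the base field. -/
theorem exists_sq_eq_of_coeff_mul_mem {K L : Type*} [Field K] [Field L] [Algebra K L]
    (R : L[X]) {ω : L} (hω : ω ≠ 0)
    (hR : ∀ j k, R.coeff j * R.coeff k * ω⁻¹ ∈ Set.range (algebraMap K L)) :
    ∃ (q : K) (A : K[X]) (c : L), A.map (algebraMap K L) = C c * R ∧
      R ^ 2 = C ω * (C q * A ^ 2).map (algebraMap K L) := by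
  by_cases h0 : R = 0
  · exact ⟨0, 0, 0, by simp, by simp [h0]⟩
  obtain ⟨j, hj⟩ : ∃ j, R.coeff j ≠ 0 := by
    by_contra! h
    exact h0 (Polynomial.ext (by simpa using h))
  choose q hq using fun k => hR j k
  -- For a fixed j with R_j ≠ 0, A is R scaled by R_j/ω, and `q j` = R_j²/ω is exactly the constant
  -- relating R² to ωA².
  set A : K[X] := ∑ k ∈ Finset.range (R.natDegree + 1), C (q k) * X ^ k with hA
  have hAm : A.map (algebraMap K L) = C (R.coeff j * ω⁻¹) * R := by
    conv_rhs => rhs; rw [R.as_sum_range_C_mul_X_pow]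
    simp only [hA, Polynomial.map_sum, Polynomial.map_mul, map_C, Polynomial.map_pow, map_X, hq,
      Finset.mul_sum]
    refine Finset.sum_congr rfl fun k _ => ?_
    rw [← mul_assoc, ← C_mul]
    congr 2
    ring
  refine ⟨(q j)⁻¹, A, _, hAm, ?_⟩
  rw [Polynomial.map_mul, Polynomial.map_pow, hAm, map_C, map_inv₀, hq, mul_pow, ← C_pow,
    ← mul_assoc, ← mul_assoc, ← C_mul, ← C_mul]
  have : ω * (R.coeff j * R.coeff j * ω⁻¹)⁻¹ * (R.coeff j * ω⁻¹) ^ 2 = 1 := by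
    field_simp
  rw [this, C_1, one_mul]

theorem reflect_prod_X_sub_C {L : Type*} [Field L] {n : ℕ} (x : Fin n → L) (hx : ∀ i, x i ≠ 0) :
    reflect n (∏ i, (X - C (x i))) = C (∏ i, -x i) * ∏ i, (X - C (x i)⁻¹) := by
  induction n with
  | zero => simp
  | succ n ih =>
    have h1 : (∏ i : Fin n, (X - C (x i.castSucc))).natDegree ≤ n := by
      rw [natDegree_prod_of_monic _ _ fun i _ => monic_X_sub_C _]
      simp
    rw [Fin.prod_univ_castSucc, Fin.prod_univ_castSucc, Fin.prod_univ_castSucc,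
      reflect_mul _ _ h1 (natDegree_X_sub_C_le _), ih _ fun i => hx _]
    have h2 : reflect 1 (X - C (x (Fin.last n))) =
        C (-x (Fin.last n)) * (X - C (x (Fin.last n))⁻¹) := by
      rw [reflect_sub, reflect_one_X, reflect_C, mul_sub, ← C_mul]
      rw [neg_mul, mul_inv_cancel₀ (hx _)]
      simp only [pow_one, map_neg, C_1]
      ring
    rw [h2, C_mul]
    ring

theorem exists_decomposition_of_gal {K L : Type*} [Field K] [CharZero K] [Field L] [Algebra K L]
    [FiniteDimensional K L] [IsGalois K L] {n : ℕ} (x : Fin n → L) (hx : ∀ i, x i ≠ 0)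
    (hγ : ∀ γ : Gal(L/K), ∃ σ : Equiv.Perm (Fin n),
      (∀ i, γ (x i) = x (σ i)) ∨ ∀ i, γ (x i) = (x (σ i))⁻¹) :
    ∃ (α β : K) (A B : K[X]), A.natDegree ≤ n ∧ B.natDegree ≤ n ∧
      reflect n A = A ∧ reflect n B = -B ∧
      (∏ i, (X - C (x i))) * ∏ i, (X - C (x i)⁻¹) =
        (C α * A ^ 2 - C β * B ^ 2).map (algebraMap K L) := by
  have : CharZero L := charZero_of_injective_algebraMap (algebraMap K L).injective
  set h : L[X] := ∏ i, (X - C (x i)) with hh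
  set k : L[X] := ∏ i, (X - C (x i)⁻¹) with hk
  set ω : L := ∏ i, -x i with hω
  have hω0 : ω ≠ 0 := Finset.prod_ne_zero_iff.2 fun i _ => neg_ne_zero.2 (hx i)
  have rh : reflect n h = C ω * k := reflect_prod_X_sub_C x hx
  have rk : reflect n (C ω * k) = h := by rw [← rh, reflect_reflect]
  have dh : h.natDegree ≤ n := by
    rw [hh, natDegree_prod_of_monic _ _ fun i _ => monic_X_sub_C _]; simp
  have dk : k.natDegree ≤ n := by
    rw [hk, natDegree_prod_of_monic _ _ fun i _ => monic_X_sub_C _]; simp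
  have dωk : (C ω * k).natDegree ≤ n := (natDegree_C_mul_le _ _).trans dk
  have hfix : ∀ γ : Gal(L/K),
      (h.map (γ : L →+* L) = h ∧ k.map (γ : L →+* L) = k ∧ γ ω = ω) ∨
      (h.map (γ : L →+* L) = k ∧ k.map (γ : L →+* L) = h ∧ γ ω = ω⁻¹) := by
    intro γ
    obtain ⟨σ, hσ | hσ⟩ := hγ γ
    · left
      refine ⟨?_, ?_, ?_⟩
      · simp only [hh, Polynomial.map_prod, Polynomial.map_sub, map_X, map_C, RingHom.coe_coe, hσ]
        exact Equiv.prod_comp σ fun i => X - C (x i)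
      · simp only [hk, Polynomial.map_prod, Polynomial.map_sub, map_X, map_C, RingHom.coe_coe, hσ,
          map_inv₀]
        exact Equiv.prod_comp σ fun i => X - (C (x i)⁻¹)
      · simp only [hω, map_prod, map_neg, hσ]
        exact Equiv.prod_comp σ fun i => - x i
    · right
      refine ⟨?_, ?_, ?_⟩
      · simp only [hh, Polynomial.map_prod, Polynomial.map_sub, map_X, map_C, RingHom.coe_coe, hσ]
        exact Equiv.prod_comp σ fun i => X - C (x i)⁻¹
      · simp only [hk, Polynomial.map_prod, Polynomial.map_sub, map_X, map_C, RingHom.coe_coe, hσ,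
          map_inv₀, inv_inv]
        exact Equiv.prod_comp σ fun i => X - (C (x i))
      · simp only [hω, map_prod, map_neg, hσ, ← Finset.prod_inv_distrib, ← inv_neg]
        exact Equiv.prod_comp σ fun i => (- x i)⁻¹
  -- A swap turns h + eωk into k + eω⁻¹h = eω⁻¹(h + eωk). In a product of two coefficients the
  -- factor is e²ω⁻² = ω⁻², which is undone by ω⁻¹ ↦ ω. The cases used are e = 1 and e = -1.
  have key : ∀ e : L, (∀ γ : Gal(L/K), γ e = e) → e ^ 2 = 1 → ∀ i j,
      (h + C e * (C ω * k)).coeff i * (h + C e * (C ω * k)).coeff j * ω⁻¹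
        ∈ Set.range (algebraMap K L) := by
    intro e he he2 i j
    refine (IsGalois.mem_range_algebraMap_iff_fixed _).2 fun γ => ?_
    rcases hfix γ with ⟨h1, h2, h3⟩ | ⟨h1, h2, h3⟩
    · have hc : ∀ i, γ (h.coeff i) = h.coeff i := fun i => by
        conv_rhs => rw [← h1, coeff_map]
        rfl
      have kc : ∀ i, γ (k.coeff i) = k.coeff i := fun i => by
        conv_rhs => rw [← h2, coeff_map]
        rfl
      simp only [coeff_add, coeff_C_mul, map_mul, map_add, map_inv₀, hc, kc, h3, he]
    · have hc : ∀ i, γ (h.coeff i) = k.coeff i := fun i => by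
        rw [← h1, coeff_map]
        rfl
      have kc : ∀ i, γ (k.coeff i) = h.coeff i := fun i => by
        rw [← h2, coeff_map]
        rfl
      simp only [coeff_add, coeff_C_mul, map_mul, map_add, map_inv₀, hc, kc, h3, he, inv_inv]
      field_simp
      linear_combination (h.coeff i * h.coeff j - k.coeff i * ω ^ 2 * k.coeff j) * he2
  obtain ⟨q, A, c, hA, hq⟩ := exists_sq_eq_of_coeff_mul_mem _ hω0
    (key 1 (fun γ => map_one γ) (by norm_num))
  obtain ⟨r, B, d, hB, hr⟩ := exists_sq_eq_of_coeff_mul_mem _ hω0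
    (key (-1) (fun γ => by simp) (by norm_num))
  have hinj := Polynomial.map_injective _ (algebraMap K L).injective
  rw [C_1, one_mul] at hA hq
  rw [C_neg, C_1, neg_one_mul, ← sub_eq_add_neg] at hB hr
  refine ⟨q / 4, r / 4, A, B, ?_, ?_, ?_, ?_, ?_⟩
  · rw [← natDegree_map (algebraMap K L), hA]
    exact (natDegree_C_mul_le _ _).trans ((natDegree_add_le _ _).trans (max_le dh dωk))
  · rw [← natDegree_map (algebraMap K L), hB]
    exact (natDegree_C_mul_le _ _).trans ((natDegree_sub_le _ _).trans (max_le dh dωk))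
  · apply hinj
    rw [← reflect_map, hA, reflect_C_mul, reflect_add, rh, rk, add_comm]
  · apply hinj
    rw [← reflect_map, Polynomial.map_neg, hB, reflect_C_mul, reflect_sub, rh, rk]
    ring
  · have h4 : C (4 * ω) * (h * k) =
        C (4 * ω) * (C (q / 4) * A ^ 2 - C (r / 4) * B ^ 2).map (algebraMap K L) := by
      have e1 : C (4 * ω) * (C (q / 4) * A ^ 2 - C (r / 4) * B ^ 2).map (algebraMap K L) =
          C ω * (C q * A ^ 2).map (algebraMap K L) -
            C ω * (C r * B ^ 2).map (algebraMap K L) := by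
        have h4' : C (4 * ω) = C ω * (C (4 : K)).map (algebraMap K L) := by
          rw [map_C, ← C_mul, mul_comm, map_ofNat]
        rw [h4', mul_assoc, ← Polynomial.map_mul, ← mul_sub, ← Polynomial.map_sub, mul_sub,
          ← mul_assoc, ← mul_assoc, ← C_mul, ← C_mul, show 4 * (q / 4) = q by ring,
          show 4 * (r / 4) = r by ring]
      rw [e1, ← hq, ← hr, C_mul, C_ofNat]
      ring
    have h40 : (4 : L) ≠ 0 := by norm_num
    exact mul_left_cancel₀ (C_ne_zero.2 (mul_ne_zero h40 hω0)) h4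

attribute [local instance] Polynomial.Gal.splits_ℚ_ℂ

theorem S2.eq_one_or_eq_flip (c : S2) : c = 1 ∨ c = flip := by
  revert c
  decide

theorem S2.univ_eq : (Finset.univ : Finset S2) = {1, flip} := by
  decide

theorem map_eq_prod_of_equiv_rootSet {F : Type*} [Field F] {f : F[X]} (hsep : f.Separable)
    {ι : Type*} [Fintype ι] (e : ι ≃ f.rootSet f.SplittingField) :
    f.map (algebraMap F f.SplittingField) =
      C (algebraMap F f.SplittingField f.leadingCoeff) *
        ∏ p, (X - C (e p : f.SplittingField)) := by
  classical
  have hs := SplittingField.splits f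
  conv_lhs => rw [hs.eq_prod_roots, leadingCoeff_map]
  congr 1
  have hnd : (f.map (algebraMap F f.SplittingField)).roots.Nodup := nodup_roots hsep.map
  have : ∀ p : ι, (e p : f.SplittingField) ∈
      (f.map (algebraMap F f.SplittingField)).roots.toFinset := fun p => by
    have h := (e p).2
    simpa only [rootSet_def, aroots_def, Finset.mem_coe] using h
  rw [← Multiset.dedup_eq_self.2 hnd, ← Multiset.toFinset_val]
  change ∏ r ∈ _, (X - C r) = _
  symm
  refine Finset.prod_bij (fun p _ => (e p : f.SplittingField)) (fun p _ => this p) ?_ ?_ ?_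
  · intro p _ q _ h
    exact e.injective (Subtype.ext h)
  · intro r hr
    exact ⟨e.symm ⟨r, by rwa [rootSet_def, Finset.mem_coe]⟩, Finset.mem_univ _, by simp⟩
  · intro p _
    rfl

theorem exists_decomposition_of_rootSet_equiv {K E : Type*} [Field K] [CharZero K] [Field E]
    [Algebra K E] {n : ℕ} {f : K[X]} [Fact ((f.map (algebraMap K E)).Splits)] (hsep : f.Separable)
    (ε : Fin n × S2 ≃ f.rootSet E) (hε : ∀ i, (ε (i, flip) : E) = (ε (i, 1) : E)⁻¹)
    (hG : ∀ γ : f.Gal, ∃ w ∈ G3 n, ∀ p, Gal.galActionHom f E γ (ε p) = ε (w.act p)) :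
    ∃ (α β : K) (A B : K[X]), A.natDegree ≤ n ∧ B.natDegree ≤ n ∧
      reflect n A = A ∧ reflect n B = -B ∧ f = C α * A ^ 2 - C β * B ^ 2 := by
  let e : Fin n × S2 ≃ f.rootSet f.SplittingField :=
    ε.trans (Gal.rootsEquivRoots f E).symm
  have hιe : ∀ p, algebraMap f.SplittingField E (e p : f.SplittingField) = (ε p : E) := fun p => by
    change ((Gal.rootsEquivRoots f E (e p) : f.rootSet E) : E) = _
    simp only [e, Equiv.trans_apply, Equiv.apply_symm_apply]
  have hflip : ∀ i, (e (i, flip) : f.SplittingField) = (e (i, 1) : f.SplittingField)⁻¹ := fun i => by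
    apply (algebraMap f.SplittingField E).injective
    rw [map_inv₀, hιe, hιe, hε]
  -- A zero root would equal its own inverse (0⁻¹ = 0), so two labels would share one root.
  have hx0 : ∀ i, (e (i, 1) : f.SplittingField) ≠ 0 := fun i h => by
    have h1 := hflip i
    rw [h, inv_zero, ← h] at h1
    have h2 := (Prod.ext_iff.1 (e.injective (Subtype.ext h1))).2
    exact absurd (show flip = 1 from h2) (by decide)
  have hgal : ∀ γ : f.Gal, ∃ σ : Equiv.Perm (Fin n),
      (∀ i, γ (e (i, 1)) = e (σ i, 1)) ∨
        ∀ i, γ (e (i, 1)) = (e (σ i, 1) : f.SplittingField)⁻¹ := by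
    intro γ
    obtain ⟨w, ⟨c, hc⟩, hw⟩ := hG γ
    have hact : ∀ p, γ (e p) = (e (w.act p) : f.SplittingField) := fun p => by
      have h1 : Gal.rootsEquivRoots f E (γ • e p) = ε (w.act p) := hw p
      have h2 := (Equiv.eq_symm_apply _).2 h1
      exact congrArg Subtype.val h2
    refine ⟨w.right, ?_⟩
    rcases S2.eq_one_or_eq_flip c with rfl | rfl
    · left
      intro i
      rw [hact, Wreath.act, hc, one_mul]
    · right
      intro i
      rw [hact, Wreath.act, hc, mul_one, hflip]
  have : IsGalois K f.SplittingField := IsGalois.of_separable_splitting_field hsep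
  obtain ⟨α, β, A, B, hA, hB, rA, rB, h⟩ := exists_decomposition_of_gal
    (fun i => (e (i, 1) : f.SplittingField)) hx0 hgal
  refine ⟨f.leadingCoeff * α, f.leadingCoeff * β, A, B, hA, hB, rA, rB, ?_⟩
  apply Polynomial.map_injective _ (algebraMap K f.SplittingField).injective
  have h1 := map_eq_prod_of_equiv_rootSet hsep e
  rw [Fintype.prod_prod_type] at h1
  simp only [S2.univ_eq, Finset.prod_pair (show (1 : S2) ≠ flip by decide), hflip,
    Finset.prod_mul_distrib] at h1
  rw [h1, h, ← map_C, ← Polynomial.map_mul, C_mul, C_mul]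
  congr 1
  ring

theorem exists_toRat_eq_of_galoisContainedIn {n : ℕ} {f : ℤ[X]}
    (hsep : (toRat f).Separable) (hG : GaloisContainedIn f (G3 n)) :
    ∃ (α β : ℚ) (A B : ℚ[X]), A.natDegree ≤ n ∧ B.natDegree ≤ n ∧
      reflect n A = A ∧ reflect n B = -B ∧ toRat f = C α * A ^ 2 - C β * B ^ 2 := by
  obtain ⟨ε, hε⟩ := hG
  exact exists_decomposition_of_rootSet_equiv hsep ε.toEquiv
    (fun i => by rw [← ε.flip_eq_inv, mul_one]) hε

/-! ### Clearing denominators -/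

/-- Rules out degenerate decompositions: if α, β, A or B vanished, f would be a constant times a
square. -/
theorem ne_C_mul_sq_of_separable {K : Type*} [Field K] {f : K[X]} (hf : f.Separable)
    (hdeg : f.natDegree ≠ 0) {α : K} {A : K[X]} : f ≠ C α * A ^ 2 := by
  intro h
  have hu : IsUnit A := hf.squarefree A ⟨C α, by rw [h]; ring⟩
  apply hdeg
  have h2 := natDegree_eq_zero_of_isUnit hu
  rw [h]
  refine Nat.le_zero.1 ((natDegree_C_mul_le _ _).trans ?_)
  rw [natDegree_pow, h2]

theorem exists_isPrimitive_of_rat {A : ℚ[X]} (hA : A ≠ 0) :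
    ∃ (r : ℚ) (P : ℤ[X]), r ≠ 0 ∧ P.IsPrimitive ∧ A = C r * P.map (Int.castRingHom ℚ) := by
  obtain ⟨b, hbm, hb⟩ := IsLocalization.integerNormalization_spec (nonZeroDivisors ℤ) A
  set N := IsLocalization.integerNormalization (nonZeroDivisors ℤ) A with hN
  have hb0 : (b : ℚ) ≠ 0 := by exact_mod_cast nonZeroDivisors.ne_zero hbm
  have h1 : N.map (Int.castRingHom ℚ) = C (b : ℚ) * A := by
    rw [← smul_eq_C_mul, Int.cast_smul_eq_zsmul]
    exact hb
  have hN0 : N ≠ 0 := by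
    rintro h0
    rw [h0, Polynomial.map_zero] at h1
    exact mul_ne_zero (C_ne_zero.2 hb0) hA h1.symm
  have hc : (N.content : ℚ) ≠ 0 := by
    exact_mod_cast fun h => hN0 (content_eq_zero_iff.1 h)
  refine ⟨N.content / b, N.primPart, div_ne_zero hc hb0, N.isPrimitive_primPart, ?_⟩
  have h2 : C (b : ℚ) * A = C (N.content : ℚ) * N.primPart.map (Int.castRingHom ℚ) := by
    rw [← h1]
    conv_lhs => rw [N.eq_C_content_mul_primPart]
    simp
  apply mul_left_cancel₀ (C_ne_zero.2 hb0)
  rw [h2, ← mul_assoc, ← C_mul, mul_div_cancel₀ _ hb0]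

/-- In odd characteristic the squares of a palindromic and of an antipalindromic polynomial are
not proportional. -/
theorem sq_ne_sq_of_reflect {K : Type*} [Field K] (h2 : (2 : K) ≠ 0) {n : ℕ} {A B : K[X]}
    (hA : A ≠ 0) (hB : B ≠ 0) (rA : reflect n A = A) (rB : reflect n B = -B) {u v : K}
    (hu : u ≠ 0 ∨ v ≠ 0) : C u * A ^ 2 ≠ C v * B ^ 2 := by
  intro h
  have hv : v ≠ 0 := by
    rintro rfl
    simp only [C_0, zero_mul, mul_eq_zero, C_eq_zero, pow_eq_zero_iff two_ne_zero, hA,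
      or_false] at h
    simp [h] at hu
  have hl := congrArg leadingCoeff h
  simp only [leadingCoeff_mul, leadingCoeff_C, leadingCoeff_pow] at hl
  set a := A.leadingCoeff
  set b := B.leadingCoeff with hb
  have hb0 : b ≠ 0 := leadingCoeff_ne_zero.2 hB
  have hsq : (C b * A) ^ 2 = (C a * B) ^ 2 := by
    apply mul_left_cancel₀ (C_ne_zero.2 hv)
    calc C v * (C b * A) ^ 2 = C (v * b ^ 2) * A ^ 2 := by simp only [C_mul, C_pow]; ring
      _ = C (a ^ 2) * (C u * A ^ 2) := by rw [← hl]; simp only [C_mul, C_pow]; ring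
      _ = C v * (C a * B) ^ 2 := by rw [h]; simp only [C_pow]; ring
  -- Equal squares give bA = ±aB. One side is palindromic, the other antipalindromic, so reflecting
  -- makes bA its own negative.
  have hneg : C b * A = -(C b * A) := by
    rcases sq_eq_sq_iff_eq_or_eq_neg.1 hsq with h1 | h1
    · have := congrArg (reflect n) h1
      rw [reflect_C_mul, reflect_C_mul, rA, rB, mul_neg, ← h1] at this
      exact this
    · have := congrArg (reflect n) h1
      rw [reflect_neg, reflect_C_mul, reflect_C_mul, rA, rB, mul_neg, ← mul_neg, ← mul_neg,
        neg_neg] at this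
      rw [← this] at h1
      exact h1
  have h0 : C (2 * b) * A = 0 := by
    rw [C_mul, C_ofNat]
    linear_combination hneg
  exact mul_ne_zero (C_ne_zero.2 (mul_ne_zero h2 hb0)) hA h0

theorem map_ne_zero_of_isPrimitive {p : ℕ} [hp : Fact p.Prime] {A : ℤ[X]} (hA : A.IsPrimitive) :
    A.map (Int.castRingHom (ZMod p)) ≠ 0 := by
  intro h
  have h1 : C (p : ℤ) ∣ A := by
    rw [C_dvd_iff_dvd_coeff]
    intro i
    have := congrArg (fun q => q.coeff i) h
    simp only [coeff_map, coeff_zero, eq_intCast] at this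
    exact (ZMod.intCast_zmod_eq_zero_iff_dvd _ _).1 this
  have h2 := hA _ h1
  have := Int.natAbs_of_isUnit h2
  simp only [Int.natAbs_natCast] at this
  exact hp.out.one_lt.ne' this

/-- Modulo p the right side vanishes and uA² = vB² remains, with A and B nonzero because they are
primitive. This forces u and v to vanish modulo p. -/
theorem not_odd_prime_dvd {n : ℕ} {A B f : ℤ[X]} (hA : A.IsPrimitive) (hB : B.IsPrimitive)
    (rA : reflect n A = A) (rB : reflect n B = -B) {u v w : ℤ}
    (h : C u * A ^ 2 - C v * B ^ 2 = C w * f) {p : ℕ} (hp : p.Prime) (hp2 : p ≠ 2)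
    (hw : (p : ℤ) ∣ w) : (p : ℤ) ∣ u ∧ (p : ℤ) ∣ v := by
  have : Fact p.Prime := ⟨hp⟩
  by_contra hcon
  have h1 := congrArg (Polynomial.map (Int.castRingHom (ZMod p))) h
  simp only [Polynomial.map_sub, Polynomial.map_mul, Polynomial.map_pow, map_C,
    Int.coe_castRingHom] at h1
  rw [(ZMod.intCast_zmod_eq_zero_iff_dvd w p).2 hw, C_0, zero_mul, sub_eq_zero] at h1
  refine sq_ne_sq_of_reflect (n := n) ?_ (map_ne_zero_of_isPrimitive (p := p) hA)
    (map_ne_zero_of_isPrimitive (p := p) hB) (by rw [reflect_map, rA])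
    (by rw [reflect_map, rB, Polynomial.map_neg]) ?_ h1
  · have h3 : ((2 : ℕ) : ZMod p) ≠ 0 := by
      rw [Ne, ZMod.natCast_eq_zero_iff]
      exact fun h => hp2 ((Nat.prime_dvd_prime_iff_eq hp Nat.prime_two).1 h)
    exact_mod_cast h3
  · rw [Ne, Ne, ZMod.intCast_zmod_eq_zero_iff_dvd, ZMod.intCast_zmod_eq_zero_iff_dvd]
    tauto

/-- The form divides B³ - D³, so a zero has B and D of equal degree. Over 𝔽₂ its top coefficient is
then 1 + 1 + 1 ≠ 0. -/
theorem sq_add_mul_add_sq_ne_zero {B D : (ZMod 2)[X]} (hB : B ≠ 0) :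
    B ^ 2 + B * D + D ^ 2 ≠ 0 := by
  intro h
  have hD : D ≠ 0 := by
    rintro rfl
    simp [hB] at h
  have hcube : B ^ 3 = D ^ 3 := by linear_combination (B - D) * h
  have hdeg : B.natDegree = D.natDegree := by
    have := congrArg natDegree hcube
    simp only [natDegree_pow] at this
    omega
  have hone : ∀ c : ZMod 2, c ≠ 0 → c = 1 := by decide
  have hB1 : B.coeff D.natDegree = 1 := by
    rw [← hdeg]
    exact hone _ (leadingCoeff_ne_zero.2 hB)
  have hD1 : D.coeff D.natDegree = 1 := hone _ (leadingCoeff_ne_zero.2 hD)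
  have hc := congrArg (fun q => q.coeff (D.natDegree + D.natDegree)) h
  simp only [coeff_add, coeff_zero, sq] at hc
  rw [coeff_mul_add_eq_of_natDegree_le hdeg.le hdeg.le, coeff_mul_add_eq_of_natDegree_le hdeg.le le_rfl,
    coeff_mul_add_eq_of_natDegree_le le_rfl le_rfl, hB1, hD1] at hc
  exact absurd hc (by decide)

/-- Modulo 2 palindromic and antipalindromic coincide, so a finer argument is needed. If u, v are
not both even, both are odd and A = B + 2D, where D reflects to B + D. Expanding, (u - v)B² + 4u(BD
+ D²) is divisible by 8, and primitivity of B gives u - v = 4k. Dividing by 4 leaves kB² + BD + D² =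
0 modulo 2. For k even, D or its reflection B + D vanishes, hence both do and B = 0. For k odd, the
form above has no zero. -/
theorem two_dvd_of_eight_dvd {n : ℕ} {A B f : ℤ[X]} (hA : A.IsPrimitive) (hB : B.IsPrimitive)
    (rA : reflect n A = A) (rB : reflect n B = -B) {u v w : ℤ}
    (h : C u * A ^ 2 - C v * B ^ 2 = C w * f) (hw : 8 ∣ w) : 2 ∣ u ∧ 2 ∣ v := by
  by_contra hcon
  let φ : ℤ[X] →+* (ZMod 2)[X] := mapRingHom (Int.castRingHom (ZMod 2))
  have φC : ∀ c : ℤ, φ (C c) = C (c : ZMod 2) := fun c => by simp [φ]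
  have hA2 : φ A ≠ 0 := map_ne_zero_of_isPrimitive (p := 2) hA
  have hB2 : φ B ≠ 0 := map_ne_zero_of_isPrimitive (p := 2) hB
  have two0 : C ((2 : ℤ) : ZMod 2) = 0 := by
    rw [show ((2 : ℤ) : ZMod 2) = 0 by decide, C_0]
  obtain ⟨w', rfl⟩ := hw
  have dvd2 : ∀ c : ℤ, (c : ZMod 2) = 0 ↔ 2 ∣ c := fun c =>
    ZMod.intCast_zmod_eq_zero_iff_dvd c 2
  have hone : ∀ c : ZMod 2, c ≠ 0 → c = 1 := by decide
  have h1 := congrArg φ h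
  simp only [map_sub, map_mul, map_pow, φC] at h1
  rw [(dvd2 8).2 ⟨4, rfl⟩, C_0, zero_mul, zero_mul, sub_eq_zero] at h1
  have hu : (u : ZMod 2) ≠ 0 := by
    intro hu
    have hv : (v : ZMod 2) ≠ 0 := fun hv => hcon ⟨(dvd2 u).1 hu, (dvd2 v).1 hv⟩
    rw [hu, hone _ hv] at h1
    rw [C_0, C_1, zero_mul, one_mul] at h1
    exact pow_ne_zero 2 hB2 h1.symm
  have hv : (v : ZMod 2) ≠ 0 := by
    intro hv
    rw [hv, hone _ hu] at h1
    rw [C_0, C_1, zero_mul, one_mul] at h1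
    exact pow_ne_zero 2 hA2 h1
  have hAB : φ A = φ B := by
    rw [hone _ hu, hone _ hv, C_1, one_mul, one_mul] at h1
    rcases sq_eq_sq_iff_eq_or_eq_neg.1 h1 with h2 | h2
    · exact h2
    · rw [h2, CharTwo.neg_eq]
  obtain ⟨D, hD⟩ : C (2 : ℤ) ∣ A - B := by
    rw [C_dvd_iff_dvd_coeff]
    intro i
    have h2 := congrArg (fun q => q.coeff i) hAB
    simp only [φ, coe_mapRingHom, coeff_map, Int.coe_castRingHom] at h2
    rw [← dvd2, coeff_sub, Int.cast_sub, h2, sub_self]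
  obtain rfl : A = B + C 2 * D := by rw [← hD]; ring
  have rD : reflect n D = B + D := by
    rw [reflect_add, reflect_C_mul, rB] at rA
    apply mul_left_cancel₀ (C_ne_zero.2 (two_ne_zero (α := ℤ)))
    have : (C (2 : ℤ)) * B = B + B := by rw [C_ofNat, two_mul]
    linear_combination rA - this
  have h4 : (4 : ℤ) ∣ u - v := by
    have hdvd : C (4 : ℤ) ∣ C (u - v) * B ^ 2 := by
      refine ⟨C (2 * w') * f - C u * (B * D + D ^ 2), ?_⟩
      simp only [C_mul, C_sub, C_ofNat] at h ⊢
      linear_combination h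
    rw [← dvd_content_iff_C_dvd, content_C_mul, sq, (hB.mul hB).content_eq_one, mul_one,
      dvd_normalize_iff] at hdvd
    exact hdvd
  obtain ⟨k, hk⟩ := h4
  have h5 : C k * B ^ 2 + C u * (B * D + D ^ 2) = C (2 : ℤ) * (C w' * f) := by
    apply mul_left_cancel₀ (C_ne_zero.2 (four_ne_zero (α := ℤ)))
    obtain rfl : u = v + 4 * k := by linarith
    simp only [C_mul, C_add, C_ofNat] at h ⊢
    linear_combination h
  have h6 := congrArg φ h5
  simp only [map_add, map_mul, map_pow, φC] at h6
  rw [two0, zero_mul, hone _ hu, C_1, one_mul] at h6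
  by_cases hk0 : (k : ZMod 2) = 0
  · have rφ : reflect n (φ D) = φ B + φ D := by
      rw [← map_add, ← rD]
      exact reflect_map _ _ _
    rw [hk0, C_0, zero_mul, zero_add] at h6
    have h7 : φ D * (φ B + φ D) = 0 := by linear_combination h6
    rcases mul_eq_zero.1 h7 with h8 | h8
    · rw [h8, reflect_zero, add_zero] at rφ
      exact hB2 rφ.symm
    · rw [h8, reflect_eq_zero_iff] at rφ
      rw [rφ, add_zero] at h8
      exact hB2 h8
  · rw [hone _ hk0, C_1, one_mul] at h6
    exact sq_add_mul_add_sq_ne_zero hB2 (D := φ D) (by linear_combination h6)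

/-- The least common denominator of α and β has no odd prime factor and is not divisible by 8, since
otherwise a prime could be cancelled from it and both numerators. Hence it divides 4. -/
theorem four_mul_eq_of_rat {n : ℕ} {A B f : ℤ[X]} (hA : A.IsPrimitive) (hB : B.IsPrimitive)
    (rA : reflect n A = A) (rB : reflect n B = -B) {α β : ℚ}
    (h : toRat f = C α * (toRat A) ^ 2 - C β * (toRat B) ^ 2) :
    ∃ a b : ℤ, 4 * α = a ∧ 4 * β = b := by
  -- the least positive common denominator of `α` and `β`
  have hex : ∃ w : ℕ, 0 < w ∧ ∃ u v : ℤ, w * α = u ∧ w * β = v := by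
    refine ⟨α.den * β.den, Nat.mul_pos α.pos β.pos, α.num * β.den, β.num * α.den, ?_, ?_⟩
    · push_cast
      rw [mul_right_comm, Rat.den_mul_eq_num]
    · push_cast
      rw [mul_assoc, Rat.den_mul_eq_num, mul_comm]
  classical
  obtain ⟨hw0, u, v, hu, hv⟩ := Nat.find_spec hex
  set w := Nat.find hex with hw
  have hmin : ∀ p : ℕ, 1 < p → p ∣ w → ¬ ((p : ℤ) ∣ u ∧ (p : ℤ) ∣ v) := by
    rintro p hp ⟨w', hw'⟩ ⟨⟨u', rfl⟩, ⟨v', rfl⟩⟩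
    have hp0 : (p : ℚ) ≠ 0 := by positivity
    have hw'0 : 0 < w' := Nat.pos_of_ne_zero (by rintro rfl; omega)
    refine Nat.find_min hex (m := w') ?_ ⟨hw'0, u', v', ?_, ?_⟩
    · rw [← hw, hw']; nlinarith
    · apply mul_left_cancel₀ hp0
      rw [hw'] at hu
      push_cast at hu
      linear_combination hu
    · apply mul_left_cancel₀ hp0
      rw [hw'] at hv
      push_cast at hv
      linear_combination hv
  have hint : C u * A ^ 2 - C v * B ^ 2 = C (w : ℤ) * f := by
    apply Polynomial.map_injective _ (Int.castRingHom ℚ).injective_int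
    simp only [Polynomial.map_sub, Polynomial.map_mul, Polynomial.map_pow, map_C,
      Int.coe_castRingHom, Int.cast_natCast]
    rw [← hu, ← hv, C_mul, C_mul]
    linear_combination -C (w : ℚ) * h
  have h8 : ¬ 8 ∣ w := fun h8 => hmin 2 one_lt_two ((by norm_num : 2 ∣ 8).trans h8)
    (two_dvd_of_eight_dvd hA hB rA rB hint (by exact_mod_cast h8))
  have h4 : w ∣ 4 := by
    rcases w.eq_two_pow_or_exists_odd_prime_and_dvd with ⟨k, hk⟩ | ⟨p, hp, hpw, hp2⟩
    · rw [hk, show 8 = 2 ^ 3 by norm_num, Nat.pow_dvd_pow_iff_le_right'] at h8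
      rw [hk, show 4 = 2 ^ 2 by norm_num, Nat.pow_dvd_pow_iff_le_right']
      omega
    · refine absurd (not_odd_prime_dvd hA hB rA rB hint hp ?_ (by exact_mod_cast hpw))
        (hmin p hp.one_lt hpw)
      rintro rfl
      exact absurd hp2 (by decide)
  obtain ⟨c, hc⟩ := h4
  refine ⟨c * u, c * v, ?_, ?_⟩
  · push_cast
    rw [← hu, ← mul_assoc, show (4 : ℚ) = c * w by rw [mul_comm]; exact_mod_cast hc]
  · push_cast
    rw [← hv, ← mul_assoc, show (4 : ℚ) = c * w by rw [mul_comm]; exact_mod_cast hc]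

/-- `4 f = a A² - b B²` with `A` palindromic and `B` antipalindromic of formal degree `n`. -/
structure IsDecomposition (n : ℕ) (f : ℤ[X]) (a b : ℤ) (A B : ℤ[X]) : Prop where
  a_ne_zero : a ≠ 0
  b_ne_zero : b ≠ 0
  A_ne_zero : A ≠ 0
  B_ne_zero : B ≠ 0
  natDegree_A_le : A.natDegree ≤ n
  natDegree_B_le : B.natDegree ≤ n
  reflect_A : reflect n A = A
  reflect_B : reflect n B = -B
  eq : 4 * f = C a * A ^ 2 - C b * B ^ 2

theorem exists_isDecomposition {n : ℕ} (hn : 0 < n) {f : ℤ[X]} (hdeg : f.natDegree = 2 * n)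
    (hsep : (toRat f).Separable) (hG : GaloisContainedIn f (G3 n)) :
    ∃ a b A B, IsDecomposition n f a b A B := by
  obtain ⟨α, β, A, B, dA, dB, rA, rB, h⟩ := exists_toRat_eq_of_galoisContainedIn hsep hG
  have hinj := (Int.castRingHom ℚ).injective_int
  have hdeg' : (toRat f).natDegree ≠ 0 := by
    rw [natDegree_map_eq_of_injective hinj, hdeg]
    omega
  have hne : ∀ (γ : ℚ) (P : ℚ[X]), toRat f ≠ C γ * P ^ 2 := fun γ P =>
    ne_C_mul_sq_of_separable hsep hdeg'
  have hα : α ≠ 0 := by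
    rintro rfl
    exact hne (-β) B (by rw [h, C_neg, C_0]; ring)
  have hβ : β ≠ 0 := by
    rintro rfl
    exact hne α A (by rw [h, C_0]; ring)
  have hA : A ≠ 0 := by
    rintro rfl
    exact hne (-β) B (by rw [h, C_neg]; ring)
  have hB : B ≠ 0 := by
    rintro rfl
    exact hne α A (by rw [h]; ring)
  obtain ⟨r, P, hr, hP, rfl⟩ := exists_isPrimitive_of_rat hA
  obtain ⟨s, Q, hs, hQ, rfl⟩ := exists_isPrimitive_of_rat hB
  have hmap := Polynomial.map_injective _ hinj
  have rP : reflect n P = P := by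
    apply hmap
    rw [reflect_C_mul] at rA
    rw [← reflect_map]
    exact mul_left_cancel₀ (C_ne_zero.2 hr) rA
  have rQ : reflect n Q = -Q := by
    apply hmap
    rw [reflect_C_mul, ← mul_neg] at rB
    rw [← reflect_map, Polynomial.map_neg]
    exact mul_left_cancel₀ (C_ne_zero.2 hs) rB
  have h' : toRat f = C (α * r ^ 2) * (toRat P) ^ 2 - C (β * s ^ 2) * (toRat Q) ^ 2 := by
    rw [h]
    simp only [C_mul, C_pow]
    ring
  obtain ⟨a, b, ha, hb⟩ := four_mul_eq_of_rat hP hQ rP rQ h'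
  refine ⟨a, b, P, Q, ?_, ?_, hP.ne_zero, hQ.ne_zero, ?_, ?_, rP, rQ, ?_⟩
  · rintro rfl
    simp [hα, hr] at ha
  · rintro rfl
    simp [hβ, hs] at hb
  · rwa [natDegree_C_mul hr, natDegree_map_eq_of_injective hinj] at dA
  · rwa [natDegree_C_mul hs, natDegree_map_eq_of_injective hinj] at dB
  · apply hmap
    simp only [Polynomial.map_sub, Polynomial.map_mul, Polynomial.map_pow, map_C,
      Int.coe_castRingHom, ← ha, ← hb, Polynomial.map_ofNat]
    rw [C_mul (a := 4), C_mul (a := 4), C_ofNat]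
    linear_combination 4 * h'

/-! ### The size of the two squares -/

/-- By Lagrange interpolation at n + 1 distinct nodes, coefficients are fixed linear forms in the
values. The extra 1 in the constant only secures positivity. -/
theorem exists_norm_coeff_le_of_norm_eval_le {n : ℕ} {v : Fin (n + 1) → ℂ}
    (hv : Function.Injective v) :
    ∃ c : ℝ, 0 < c ∧ ∀ p : ℂ[X], p.natDegree ≤ n → ∀ M : ℝ, (∀ j, ‖p.eval (v j)‖ ≤ M) →
      ∀ i, ‖p.coeff i‖ ≤ c * M := by
  refine ⟨1 + ∑ i ∈ Finset.range (n + 1), ∑ j, ‖(Lagrange.basis Finset.univ v j).coeff i‖,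
    by positivity, fun p hp M hM i => ?_⟩
  have hM0 : 0 ≤ M := (norm_nonneg _).trans (hM 0)
  by_cases hi : i < n + 1
  · have hdeg : p.degree < (Finset.univ : Finset (Fin (n + 1))).card := by
      rw [Finset.card_univ, Fintype.card_fin]
      exact (degree_le_of_natDegree_le hp).trans_lt (by exact_mod_cast n.lt_succ_self)
    have hpi := Lagrange.eq_interpolate (hv.injOn (s := (Finset.univ : Finset (Fin (n + 1)))))
      hdeg
    have hle : ∑ j, ‖(Lagrange.basis Finset.univ v j).coeff i‖ ≤
        1 + ∑ i ∈ Finset.range (n + 1), ∑ j, ‖(Lagrange.basis Finset.univ v j).coeff i‖ := by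
      have := Finset.single_le_sum
        (f := fun i => ∑ j, ‖(Lagrange.basis Finset.univ v j).coeff i‖)
        (fun _ _ => by positivity) (Finset.mem_range.2 hi)
      linarith
    calc ‖p.coeff i‖ = ‖∑ j, p.eval (v j) * (Lagrange.basis Finset.univ v j).coeff i‖ := by
          conv_lhs => rw [hpi, Lagrange.interpolate_apply, finsetSum_coeff]
          simp only [coeff_C_mul]
      _ ≤ ∑ j, M * ‖(Lagrange.basis Finset.univ v j).coeff i‖ := by
          refine (norm_sum_le _ _).trans (Finset.sum_le_sum fun j _ => ?_)
          rw [norm_mul]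
          exact mul_le_mul_of_nonneg_right (hM j) (norm_nonneg _)
      _ = (∑ j, ‖(Lagrange.basis Finset.univ v j).coeff i‖) * M := by
          rw [← Finset.mul_sum, mul_comm]
      _ ≤ _ := mul_le_mul_of_nonneg_right hle hM0
  · rw [coeff_eq_zero_of_natDegree_lt (by omega), norm_zero]
    positivity

theorem norm_aeval_le {f : ℤ[X]} {N : ℕ} (hf : f.natDegree ≤ N) {H : ℝ}
    (hH : ∀ i, |(f.coeff i : ℝ)| ≤ H) {z : ℂ} (hz : ‖z‖ ≤ 1) : ‖aeval z f‖ ≤ (N + 1) * H := by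
  rw [aeval_eq_sum_range' (Nat.lt_succ_of_le hf)]
  refine (norm_sum_le _ _).trans ?_
  calc ∑ i ∈ Finset.range (N + 1), ‖f.coeff i • z ^ i‖ ≤ ∑ i ∈ Finset.range (N + 1), H := by
        refine Finset.sum_le_sum fun i _ => ?_
        rw [zsmul_eq_mul, norm_mul, norm_pow, Complex.norm_intCast]
        calc |(f.coeff i : ℝ)| * ‖z‖ ^ i ≤ |(f.coeff i : ℝ)| * 1 :=
              mul_le_mul_of_nonneg_left (pow_le_one₀ (norm_nonneg _) hz) (abs_nonneg _)
          _ ≤ H := by rw [mul_one]; exact hH i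
    _ = (N + 1) * H := by simp

theorem conj_aeval (A : ℤ[X]) (z : ℂ) :
    (starRingEnd ℂ) (aeval z A) = aeval ((starRingEnd ℂ) z) A := by
  rw [aeval_def, aeval_def, hom_eval₂]
  congr 1
  exact RingHom.ext_int _ _

/-- On the unit circle z⁻¹ is the conjugate of z. Consequently A(z)² = |A(z)|² zⁿ for palindromic A,
and B(z)² = -|B(z)|² zⁿ for antipalindromic B. -/
theorem conj_aeval_reflect_mul_pow {n : ℕ} {A : ℤ[X]} (hA : A.natDegree ≤ n) {z : ℂ}
    (hz : ‖z‖ = 1) : (starRingEnd ℂ) (aeval z (reflect n A)) * z ^ n = aeval z A := by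
  have hz0 : z ≠ 0 := by
    rintro rfl
    simp at hz
  let _ : Invertible z := invertibleOfNonzero hz0
  have h := eval₂_reflect_mul_pow (algebraMap ℤ ℂ) z n A hA
  rw [invOf_eq_inv, Complex.inv_eq_conj hz] at h
  rw [conj_aeval]
  exact h

theorem abs_mul_add_abs_mul_of_mul_pos {a b x y : ℝ} (hab : 0 < a * b) (hx : 0 ≤ x) (hy : 0 ≤ y) :
    |a| * x + |b| * y = |a * x + b * y| := by
  rcases pos_and_pos_or_neg_and_neg_of_mul_pos hab with ⟨ha, hb⟩ | ⟨ha, hb⟩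
  · rw [abs_of_pos ha, abs_of_pos hb, abs_of_nonneg (by positivity)]
  · rw [abs_of_neg ha, abs_of_neg hb, abs_of_nonpos (by nlinarith)]
    ring

/-- On the unit circle 4f(z) = (a|A(z)|² + b|B(z)|²) zⁿ, and both terms have the same sign. -/
theorem IsDecomposition.norm_sq_add_eq_of_pos {n : ℕ} {f : ℤ[X]} {a b : ℤ} {A B : ℤ[X]}
    (h : IsDecomposition n f a b A B) (hab : 0 < a * b) {z : ℂ} (hz : ‖z‖ = 1) :
    |(a : ℝ)| * ‖aeval z A‖ ^ 2 + |(b : ℝ)| * ‖aeval z B‖ ^ 2 = 4 * ‖aeval z f‖ := by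
  have hA := conj_aeval_reflect_mul_pow h.natDegree_A_le hz
  have hB := conj_aeval_reflect_mul_pow h.natDegree_B_le hz
  rw [h.reflect_A] at hA
  rw [h.reflect_B, map_neg, map_neg] at hB
  have he := congrArg (aeval z) h.eq
  simp only [map_sub, map_mul, map_pow, aeval_C, map_ofNat, algebraMap_int_eq,
    Int.coe_castRingHom] at he
  have hkey : 4 * aeval z f =
      ((a * ‖aeval z A‖ ^ 2 + b * ‖aeval z B‖ ^ 2 : ℝ) : ℂ) * z ^ n := by
    push_cast
    rw [← Complex.mul_conj', ← Complex.mul_conj', he]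
    linear_combination (-(a : ℂ) * aeval z A) * hA + ((b : ℂ) * aeval z B) * hB
  have hnorm := congrArg norm hkey
  rw [norm_mul, norm_mul, norm_pow, hz, one_pow, mul_one, Complex.norm_real,
    Real.norm_eq_abs] at hnorm
  rw [abs_mul_add_abs_mul_of_mul_pos (by exact_mod_cast hab) (by positivity) (by positivity),
    ← hnorm]
  simp

/-- At real points A and B are real, and aA² and -bB² have the same sign. -/
theorem IsDecomposition.norm_sq_add_eq_of_neg {n : ℕ} {f : ℤ[X]} {a b : ℤ} {A B : ℤ[X]}
    (h : IsDecomposition n f a b A B) (hab : a * b < 0) (x : ℝ) :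
    |(a : ℝ)| * ‖aeval (x : ℂ) A‖ ^ 2 + |(b : ℝ)| * ‖aeval (x : ℂ) B‖ ^ 2 =
      4 * ‖aeval (x : ℂ) f‖ := by
  have hreal : ∀ P : ℤ[X], ‖aeval (x : ℂ) P‖ = |aeval x P| := fun P => by
    rw [← Real.norm_eq_abs, ← Complex.norm_real]
    congr 1
    exact aeval_algebraMap_apply ℂ x P
  have he := congrArg (aeval x) h.eq
  simp only [map_sub, map_mul, map_pow, aeval_C, map_ofNat, algebraMap_int_eq,
    Int.coe_castRingHom] at he
  have hab' : 0 < (a : ℝ) * (-b : ℝ) := by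
    have : (a : ℝ) * b < 0 := by exact_mod_cast hab
    linarith
  rw [hreal, hreal, hreal, sq_abs, sq_abs, ← abs_neg (b : ℝ),
    abs_mul_add_abs_mul_of_mul_pos hab' (by positivity) (by positivity), neg_mul,
    ← sub_eq_add_neg, ← he, abs_mul]
  simp

/-- The interpolation nodes are chosen where the two squares do not cancel: (n+1)-th roots of unity
for ab > 0, the reals 1/(j+1) for ab < 0. All lie in the closed unit disc, where |f| ≤ (2n+1)H. -/
theorem exists_coeff_sq_le (n : ℕ) : ∃ c : ℝ, 1 ≤ c ∧ ∀ (H : ℝ) (f : ℤ[X]) (a b : ℤ) (A B : ℤ[X]),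
    f.natDegree = 2 * n → (∀ i, |(f.coeff i : ℝ)| ≤ H) → IsDecomposition n f a b A B →
      ∀ i, |(a : ℝ)| * (A.coeff i : ℝ) ^ 2 ≤ c * H ∧ |(b : ℝ)| * (B.coeff i : ℝ) ^ 2 ≤ c * H := by
  -- interpolation turns bounds at suitable points into bounds for coefficients
  have hbound : ∀ v : Fin (n + 1) → ℂ, Function.Injective v → (∀ j, ‖v j‖ ≤ 1) →
      ∃ c : ℝ, 0 < c ∧ ∀ (H : ℝ) (f : ℤ[X]) (a : ℤ) (A : ℤ[X]), a ≠ 0 → A.natDegree ≤ n →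
        f.natDegree = 2 * n → (∀ i, |(f.coeff i : ℝ)| ≤ H) →
        (∀ j, |(a : ℝ)| * ‖aeval (v j) A‖ ^ 2 ≤ 4 * ‖aeval (v j) f‖) →
        ∀ i, |(a : ℝ)| * (A.coeff i : ℝ) ^ 2 ≤ c * H := by
    intro v hv hv1
    obtain ⟨c, hc, hcM⟩ := exists_norm_coeff_le_of_norm_eval_le hv
    refine ⟨c ^ 2 * (4 * (2 * n + 1)), by positivity, fun H f a A ha hA hf hH hval i => ?_⟩
    have ha' : 0 < |(a : ℝ)| := abs_pos.2 (by exact_mod_cast ha)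
    have hH0 : 0 ≤ H := (abs_nonneg _).trans (hH 0)
    set M := √(4 * (2 * n + 1) * H / |(a : ℝ)|) with hMdef
    have hM2 : M ^ 2 = 4 * (2 * n + 1) * H / |(a : ℝ)| := Real.sq_sqrt (by positivity)
    have hev : ∀ j, ‖(A.map (algebraMap ℤ ℂ)).eval (v j)‖ ≤ M := fun j => by
      refine Real.le_sqrt_of_sq_le ?_
      rw [eval_map_algebraMap, le_div_iff₀ ha', mul_comm]
      have h1 := norm_aeval_le hf.le hH (hv1 j)
      push_cast at h1
      linarith [hval j]
    have hco := hcM (A.map (algebraMap ℤ ℂ)) (natDegree_map_le.trans hA) M hev i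
    rw [coeff_map, algebraMap_int_eq, Int.coe_castRingHom, Complex.norm_intCast] at hco
    have hsq : (A.coeff i : ℝ) ^ 2 ≤ (c * M) ^ 2 := by
      rw [← sq_abs]
      exact pow_le_pow_left₀ (abs_nonneg _) hco 2
    calc |(a : ℝ)| * (A.coeff i : ℝ) ^ 2 ≤ |(a : ℝ)| * (c * M) ^ 2 :=
          mul_le_mul_of_nonneg_left hsq ha'.le
      _ = _ := by rw [mul_pow, hM2]; field_simp
  have hζ := Complex.isPrimitiveRoot_exp (n + 1) n.succ_ne_zero
  set ζ := Complex.exp (2 * Real.pi * Complex.I / (n + 1 : ℕ)) with hζdef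
  have hζ1 : ‖ζ‖ = 1 := hζ.norm'_eq_one n.succ_ne_zero
  obtain ⟨c₁, hc₁, h₁⟩ := hbound (fun j => ζ ^ (j : ℕ))
    (fun i j hij => Fin.ext (hζ.pow_inj i.2 j.2 hij)) (fun j => by simp [hζ1])
  obtain ⟨c₂, hc₂, h₂⟩ := hbound (fun j => (((1 / ((j : ℕ) + 1) : ℝ)) : ℂ))
    (fun i j hij => by
      have h3 : (1 / (((i : ℕ) : ℝ) + 1)) = 1 / (((j : ℕ) : ℝ) + 1) := Complex.ofReal_injective hij
      have h4 : ((i : ℕ) : ℝ) + 1 = ((j : ℕ) : ℝ) + 1 := by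
        simpa using h3
      exact Fin.ext (by exact_mod_cast add_right_cancel h4))
    (fun j => by
      rw [Complex.norm_real, Real.norm_of_nonneg (by positivity)]
      exact div_le_one_of_le₀ (by linarith [Nat.cast_nonneg (α := ℝ) (j : ℕ)]) (by positivity))
  refine ⟨1 + c₁ + c₂, by linarith, fun H f a b A B hf hH h i => ?_⟩
  have hH0 : 0 ≤ H := (abs_nonneg _).trans (hH 0)
  have hle₁ : c₁ * H ≤ (1 + c₁ + c₂) * H := mul_le_mul_of_nonneg_right (by linarith) hH0
  have hle₂ : c₂ * H ≤ (1 + c₁ + c₂) * H := mul_le_mul_of_nonneg_right (by linarith) hH0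
  have hnn : ∀ (d : ℤ) (P : ℤ[X]) (z : ℂ), 0 ≤ |(d : ℝ)| * ‖aeval z P‖ ^ 2 :=
    fun d P z => by positivity
  rcases lt_or_gt_of_ne (mul_ne_zero h.a_ne_zero h.b_ne_zero) with hab | hab
  · have hv := fun j : Fin (n + 1) => h.norm_sq_add_eq_of_neg hab (1 / ((j : ℕ) + 1))
    exact ⟨(h₂ H f a A h.a_ne_zero h.natDegree_A_le hf hH
        (fun j => by linarith [hv j, hnn b B (((1 / ((j : ℕ) + 1) : ℝ)) : ℂ)]) i).trans hle₂,
      (h₂ H f b B h.b_ne_zero h.natDegree_B_le hf hH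
        (fun j => by linarith [hv j, hnn a A (((1 / ((j : ℕ) + 1) : ℝ)) : ℂ)]) i).trans hle₂⟩
  · have hv := fun j : Fin (n + 1) => h.norm_sq_add_eq_of_pos hab
      (z := ζ ^ (j : ℕ)) (by rw [norm_pow, hζ1, one_pow])
    exact ⟨(h₁ H f a A h.a_ne_zero h.natDegree_A_le hf hH
        (fun j => by linarith [hv j, hnn b B (ζ ^ (j : ℕ))]) i).trans hle₁,
      (h₁ H f b B h.b_ne_zero h.natDegree_B_le hf hH
        (fun j => by linarith [hv j, hnn a A (ζ ^ (j : ℕ))]) i).trans hle₁⟩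

/-! ### Solutions of `u² - D w² = 4` -/

/-- ε² - 1 = εw√D, where ε ≥ √D and w ≥ 1. This gap is the source of every factor 1/log(D+1). -/
theorem pell_add_one_le_sq {D : ℕ} {w : ℤ} (hw : 0 < w) {ε : ℝ}
    (hε : 0 < ε) (h : ε - ε⁻¹ = w * √D) : (D : ℝ) + 1 ≤ ε ^ 2 := by
  have hw1 : (1 : ℝ) ≤ w := by exact_mod_cast hw
  have hD := Real.sqrt_nonneg (D : ℝ)
  have h1 : √D ≤ ε - ε⁻¹ := by rw [h]; nlinarith
  have h2 : √D ≤ ε := h1.trans (by linarith [inv_pos.2 hε])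
  have h3 : √(D : ℝ) * √D = D := Real.mul_self_sqrt D.cast_nonneg
  have h4 : ε * ε⁻¹ = 1 := mul_inv_cancel₀ hε.ne'
  nlinarith [mul_le_mul_of_nonneg_left h1 hε.le, mul_le_mul_of_nonneg_right h2 hD]

theorem pell_unit_inv {D : ℕ} {u w : ℤ} (h : u ^ 2 - D * w ^ 2 = 4) :
    ((u + w * √D) / 2 : ℝ)⁻¹ = (u - w * √D) / 2 := by
  have h3 : √(D : ℝ) * √D = D := Real.mul_self_sqrt D.cast_nonneg
  have h' : (u : ℝ) ^ 2 - D * (w : ℝ) ^ 2 = 4 := by exact_mod_cast h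
  refine inv_eq_of_mul_eq_one_right ?_
  linear_combination (1 / 4) * h' - (w : ℝ) ^ 2 / 4 * h3

/-- The quotient of two units is again of the form (x + y√D)/2 with integers x and y > 0, so the gap
bound for a single unit applies to it. -/
theorem pell_unit_ratio {D : ℕ} {u w u' w' : ℤ} (hu : 0 < u) (hw : 0 < w) (hu' : 0 < u')
    (hw' : 0 < w') (h : u ^ 2 - D * w ^ 2 = 4) (h' : u' ^ 2 - D * w' ^ 2 = 4)
    (hlt : (u + w * √D) / 2 < (u' + w' * √D) / 2) :
    ((D : ℝ) + 1) * ((u + w * √D) / 2) ^ 2 ≤ ((u' + w' * √D) / 2) ^ 2 := by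
  -- Parity information that makes uu' - Dww' and uw' - u'w even, so that the quotient has
  -- denominator 2 instead of 4.
  have hpar : ∀ {u w : ℤ}, u ^ 2 - D * w ^ 2 = 4 → (Even u ↔ (Even (D : ℤ) ∨ Even w)) := by
    intro u w h
    have h1 : Even (u ^ 2 - D * w ^ 2) := by rw [h]; decide
    simpa [Int.even_sub, Int.even_mul, Int.even_pow] using h1
  have p := hpar h
  have p' := hpar h'
  obtain ⟨x, hx⟩ : Even (u * u' - D * (w * w')) := by
    simp only [Int.even_sub, Int.even_mul]
    tauto
  obtain ⟨y, hy⟩ : Even (u * w' - u' * w) := by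
    simp only [Int.even_sub, Int.even_mul]
    tauto
  set ε : ℝ := (u + w * √D) / 2 with hε
  set ε' : ℝ := (u' + w' * √D) / 2 with hε'
  have hε0 : 0 < ε := by positivity
  have hε'0 : 0 < ε' := by positivity
  have i1 : ε⁻¹ = (u - w * √D) / 2 := pell_unit_inv h
  have i2 : ε'⁻¹ = (u' - w' * √D) / 2 := pell_unit_inv h'
  have h3 : √(D : ℝ) * √D = D := Real.mul_self_sqrt D.cast_nonneg
  have hx' : (u : ℝ) * u' - D * (w * w') = x + x := by exact_mod_cast hx
  have hy' : (u : ℝ) * w' - u' * w = y + y := by exact_mod_cast hy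
  have hr : (ε' * ε⁻¹) - (ε' * ε⁻¹)⁻¹ = y * √D := by
    rw [mul_inv, inv_inv, i1, i2, hε, hε']
    linear_combination (√D / 2) * hy'
  have hr1 : 1 < ε' * ε⁻¹ := by
    rw [← div_eq_mul_inv, one_lt_div hε0]
    exact hlt
  have hy0 : 0 < y := by
    have h5 : 0 < (y : ℝ) * √D := by
      rw [← hr]
      have := inv_lt_one_of_one_lt₀ hr1
      linarith
    exact_mod_cast pos_of_mul_pos_left h5 (Real.sqrt_nonneg _)
  have h6 := pell_add_one_le_sq hy0 (by positivity) hr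
  rw [mul_pow, inv_pow, ← div_eq_mul_inv, le_div_iff₀ (by positivity)] at h6
  exact h6

/-- Up to the four sign choices, the numbers log ε lie between ℓ = log(D+1)/2 and log U and are at
least ℓ apart. Hence `⌊log ε / ℓ⌋` separates them and takes at most log U / ℓ values. -/
theorem card_pell_le {D : ℕ} (hD : 0 < D) {U : ℝ} (hU : 1 ≤ U) (T : Finset (ℤ × ℤ))
    (hT : ∀ p ∈ T, p.1 ^ 2 - D * p.2 ^ 2 = 4 ∧ p.2 ≠ 0 ∧ |(p.1 : ℝ)| ≤ U) :
    (T.card : ℝ) ≤ 8 * (Real.log U / Real.log (D + 1)) := by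
  have hDr : (1 : ℝ) ≤ D := by exact_mod_cast hD
  have hL : 0 < Real.log ((D : ℝ) + 1) := Real.log_pos (by linarith)
  set ℓ := Real.log ((D : ℝ) + 1) / 2 with hℓ
  have hℓ0 : 0 < ℓ := by positivity
  let ε : ℤ × ℤ → ℝ := fun p => ((|p.1| : ℤ) + (|p.2| : ℤ) * √D) / 2
  have hsol : ∀ p ∈ T, 0 < |p.1| ∧ 0 < |p.2| ∧ |p.1| ^ 2 - D * |p.2| ^ 2 = 4 ∧
      ((|p.1| : ℤ) : ℝ) ≤ U := by
    intro p hp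
    obtain ⟨h1, h2, h3⟩ := hT p hp
    refine ⟨abs_pos.2 ?_, abs_pos.2 h2, by rw [sq_abs, sq_abs, h1], by push_cast; exact h3⟩
    intro h0
    rw [h0] at h1
    have : (0 : ℤ) ≤ D * p.2 ^ 2 := by positivity
    omega
  have hε0 : ∀ p ∈ T, 0 < ε p := by
    intro p hp
    obtain ⟨h1, h2, -⟩ := hsol p hp
    have h1' : (0 : ℝ) < (|p.1| : ℤ) := by exact_mod_cast h1
    have h2' : (0 : ℝ) < (|p.2| : ℤ) := by exact_mod_cast h2
    positivity
  have hlow : ∀ p ∈ T, 1 ≤ Real.log (ε p) / ℓ := by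
    intro p hp
    obtain ⟨h1, h2, h3, -⟩ := hsol p hp
    have h4 := pell_add_one_le_sq (D := D) h2 (hε0 p hp) (by rw [pell_unit_inv h3]; ring)
    have h5 := Real.log_le_log (by positivity) h4
    rw [Real.log_pow] at h5
    rw [one_le_div hℓ0, hℓ]
    push_cast at h5
    linarith
  have hup : ∀ p ∈ T, Real.log (ε p) / ℓ ≤ Real.log U / ℓ := by
    intro p hp
    obtain ⟨h1, h2, h3, h4⟩ := hsol p hp
    refine div_le_div_of_nonneg_right (Real.log_le_log (hε0 p hp) (le_trans ?_ h4)) hℓ0.le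
    have h5 := inv_pos.2 (hε0 p hp)
    rw [pell_unit_inv h3] at h5
    change (_ + _) / 2 ≤ _
    linarith
  have hgap : ∀ p ∈ T, ∀ q ∈ T, ε p < ε q → Real.log (ε p) / ℓ + 1 ≤ Real.log (ε q) / ℓ := by
    intro p hp q hq hlt
    obtain ⟨h1, h2, h3, -⟩ := hsol p hp
    obtain ⟨k1, k2, k3, -⟩ := hsol q hq
    have h4 := Real.log_le_log (by have := hε0 p hp; positivity)
      (pell_unit_ratio h1 h2 k1 k2 h3 k3 hlt)
    change Real.log (_ * ε p ^ 2) ≤ Real.log (ε q ^ 2) at h4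
    rw [Real.log_mul (by positivity) (pow_pos (hε0 p hp) 2).ne', Real.log_pow, Real.log_pow,
      Nat.cast_two] at h4
    rw [← sub_nonneg]
    have : Real.log (ε q) / ℓ - (Real.log (ε p) / ℓ + 1) =
      (Real.log (ε q) - Real.log (ε p) - ℓ) / ℓ := by field_simp; ring
    rw [this]
    refine div_nonneg ?_ hℓ0.le
    rw [hℓ]
    linarith
  -- Comparing both ε and ε⁻¹ recovers |u| and |w| without irrationality of √D, so D may be a
  -- square.
  have hinj : ∀ p ∈ T, ∀ q ∈ T, ε p = ε q → |p.1| = |q.1| ∧ |p.2| = |q.2| := by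
    intro p hp q hq heq
    obtain ⟨h1, h2, h3, -⟩ := hsol p hp
    obtain ⟨k1, k2, k3, -⟩ := hsol q hq
    have e2 := congrArg (·⁻¹) heq
    simp only [ε] at heq e2
    rw [pell_unit_inv h3, pell_unit_inv k3] at e2
    have hs : 0 < √(D : ℝ) := Real.sqrt_pos.2 (by linarith)
    constructor
    · have : ((|p.1| : ℤ) : ℝ) = (|q.1| : ℤ) := by linarith
      exact_mod_cast this
    · have : ((|p.2| : ℤ) : ℝ) * √D = (|q.2| : ℤ) * √D := by linarith
      exact_mod_cast mul_right_cancel₀ hs.ne' this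
  have hcard : T.card ≤ ((Finset.univ : Finset (Bool × Bool)) ×ˢ
      Finset.Icc 1 ⌊Real.log U / ℓ⌋₊).card := by
    refine Finset.card_le_card_of_injOn
      (fun p => ((decide (0 < p.1), decide (0 < p.2)), ⌊Real.log (ε p) / ℓ⌋₊)) ?_ ?_
    · intro p hp
      rw [Finset.mem_coe] at hp
      simp only [Finset.coe_product, Set.mem_prod, Finset.mem_coe, Finset.mem_univ, true_and,
        Finset.mem_Icc]
      exact ⟨Nat.le_floor (by exact_mod_cast hlow p hp), Nat.floor_le_floor (hup p hp)⟩
    · intro p hp q hq hpq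
      rw [Finset.mem_coe] at hp hq
      simp only [Prod.mk.injEq, decide_eq_decide] at hpq
      obtain ⟨⟨s1, s2⟩, hf⟩ := hpq
      have hge : ∀ p ∈ T, ∀ q ∈ T, ⌊Real.log (ε p) / ℓ⌋₊ = ⌊Real.log (ε q) / ℓ⌋₊ →
          ε q ≤ ε p := by
        intro p hp q hq hf
        by_contra! hlt
        have h1 := hgap p hp q hq hlt
        have h2 := Nat.lt_floor_add_one (Real.log (ε q) / ℓ)
        have h3 := Nat.floor_le (zero_le_one.trans (hlow p hp))
        rw [hf] at h3
        linarith
      obtain ⟨e1, e2⟩ := hinj p hp q hq (le_antisymm (hge q hq p hp hf.symm) (hge p hp q hq hf))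
      have n1 := (hsol p hp).1
      have n2 := (hsol p hp).2.1
      refine Prod.ext ?_ ?_
      · rcases abs_eq_abs.1 e1 with h | h
        · exact h
        · rw [abs_pos] at n1
          omega
      · rcases abs_eq_abs.1 e2 with h | h
        · exact h
        · rw [abs_pos] at n2
          omega
  have hnn : 0 ≤ Real.log U / ℓ := div_nonneg (Real.log_nonneg hU) hℓ0.le
  calc (T.card : ℝ) ≤ (4 * ⌊Real.log U / ℓ⌋₊ : ℕ) := by
        have : (Finset.univ : Finset (Bool × Bool)).card = 4 := rfl
        rw [Finset.card_product, this, Nat.card_Icc, Nat.add_sub_cancel] at hcard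
        exact_mod_cast hcard
    _ ≤ 4 * (Real.log U / ℓ) := by
        push_cast
        linarith [Nat.floor_le hnn]
    _ = _ := by rw [hℓ]; field_simp; ring

/-! ### Quadruples with `a s² - b t² = 4` -/

/-- The square of gcd(t₀, s) divides (u + 2) - (u - 2) = 4, so this gcd divides 2. Now s divides
s₀t₀, hence also s₀ gcd(t₀, s). -/
theorem dvd_two_mul_of_factorization {u s t s₀ t₀ : ℤ} (hs : s ^ 2 ∣ u + 2)
    (ht₀ : t₀ ^ 2 ∣ u - 2) (h : s * t = s₀ * t₀) : s ∣ 2 * s₀ := by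
  have hg : ((Int.gcd t₀ s : ℕ) : ℤ) ∣ 2 := by
    have h1 : ((Int.gcd t₀ s : ℕ) : ℤ) ^ 2 ∣ 2 ^ 2 := by
      have h2 := (pow_dvd_pow_of_dvd (Int.gcd_dvd_right t₀ s) 2).trans hs
      have h3 := (pow_dvd_pow_of_dvd (Int.gcd_dvd_left t₀ s) 2).trans ht₀
      have h4 := dvd_sub h2 h3
      have h5 : u + 2 - (u - 2) = 2 ^ 2 := by ring
      rwa [h5] at h4
    exact (Int.pow_dvd_pow_iff two_ne_zero).1 h1
  have h1 : s ∣ ((Int.gcd (s₀ * t₀) (s₀ * s) : ℕ) : ℤ) :=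
    Int.dvd_coe_gcd ⟨t, h.symm⟩ ⟨s₀, mul_comm _ _⟩
  rw [Int.gcd_mul_left] at h1
  push_cast at h1
  refine h1.trans (mul_comm 2 s₀ ▸ mul_dvd_mul ?_ hg)
  simp

/-- Relative to a fixed member with third entry s₀, every s satisfies 2s₀ = sk, and by symmetry 2s =
s₀l, so kl = 4. The integer k lies in [-4, 4] and determines s, then t from st, then a and b. -/
theorem card_quadruple_fibre_le {u w : ℤ} (hw : w ≠ 0) (T : Finset (ℤ × ℤ × ℤ × ℤ))
    (hT : ∀ q ∈ T, q.1 * q.2.2.1 ^ 2 - q.2.1 * q.2.2.2 ^ 2 = 4 ∧ q.1 * q.2.2.1 ^ 2 - 2 = u ∧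
      q.2.2.1 * q.2.2.2 = w) : T.card ≤ 9 := by
  rcases T.eq_empty_or_nonempty with rfl | ⟨⟨a₀, b₀, s₀, t₀⟩, h0⟩
  · simp
  obtain ⟨e0, u0, w0⟩ := hT _ h0
  simp only at e0 u0 w0
  have hs₀ : s₀ ≠ 0 := by rintro rfl; exact hw (by rw [← w0, zero_mul])
  have hk : ∀ q ∈ T, ∃ k : ℤ, 2 * s₀ = q.2.2.1 * k ∧ k ∣ 4 := by
    rintro ⟨a, b, s, t⟩ hq
    obtain ⟨e1, u1, w1⟩ := hT _ hq
    simp only at e1 u1 w1 ⊢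
    obtain ⟨k, hk⟩ := dvd_two_mul_of_factorization (u := u) (s := s) (t := t) (s₀ := s₀) (t₀ := t₀)
      ⟨a, by linarith⟩ ⟨b₀, by linarith⟩ (w1.trans w0.symm)
    obtain ⟨l, hl⟩ := dvd_two_mul_of_factorization (u := u) (s := s₀) (t := t₀) (s₀ := s) (t₀ := t)
      ⟨a₀, by linarith⟩ ⟨b, by linarith⟩ (w0.trans w1.symm)
    refine ⟨k, hk, l, ?_⟩
    apply mul_left_cancel₀ hs₀
    linear_combination (2 : ℤ) * hk + k * hl
  choose! k hk using hk
  have hcard : T.card ≤ (Finset.Icc (-4 : ℤ) 4).card := by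
    refine Finset.card_le_card_of_injOn k ?_ ?_
    · intro q hq
      have h1 := Int.le_of_dvd (by norm_num) (hk q hq).2
      have h2 := Int.le_of_dvd (by norm_num) ((neg_dvd).2 (hk q hq).2)
      rw [Finset.mem_coe, Finset.mem_Icc]
      omega
    · rintro ⟨a, b, s, t⟩ hq ⟨a', b', s', t'⟩ hq' hkk
      obtain ⟨e1, u1, w1⟩ := hT _ hq
      obtain ⟨e2, u2, w2⟩ := hT _ hq'
      have k1 := (hk _ hq).1
      have k2 := (hk _ hq').1
      rw [← hkk] at k2
      simp only at e1 u1 w1 e2 u2 w2 k1 k2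
      have hk0 : k (a, b, s, t) ≠ 0 := by
        intro h
        rw [h, mul_zero] at k1
        exact hs₀ (by omega)
      obtain rfl : s = s' := mul_right_cancel₀ hk0 (k1.symm.trans k2)
      have hs : s ≠ 0 := by rintro rfl; exact hw (by rw [← w1, zero_mul])
      obtain rfl : t = t' := mul_left_cancel₀ hs (w1.trans w2.symm)
      have ht : t ≠ 0 := by rintro rfl; exact hw (by rw [← w1, mul_zero])
      obtain rfl : a = a' := mul_right_cancel₀ (pow_ne_zero 2 hs) (by linarith)
      obtain rfl : b = b' := mul_right_cancel₀ (pow_ne_zero 2 ht) (by linarith)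
      rfl
  simpa using hcard

/-- With u = as² - 2 and w = st one has u² - 4 = (u + 2)(u - 2) = as²·bt² = Dw². The constant is 72
= 9·8, fibre size times Pell count. -/
theorem card_quadruple_le {D : ℕ} (hD : 0 < D) {U : ℝ} (hU : 1 ≤ U)
    (T : Finset (ℤ × ℤ × ℤ × ℤ))
    (hT : ∀ q ∈ T, q.1 * q.2.2.1 ^ 2 - q.2.1 * q.2.2.2 ^ 2 = 4 ∧ q.1 * q.2.1 = D ∧
      q.2.2.1 * q.2.2.2 ≠ 0 ∧ |((q.1 * q.2.2.1 ^ 2 - 2 : ℤ) : ℝ)| ≤ U) :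
    (T.card : ℝ) ≤ 72 * (Real.log U / Real.log (D + 1)) := by
  let φ : ℤ × ℤ × ℤ × ℤ → ℤ × ℤ := fun q => (q.1 * q.2.2.1 ^ 2 - 2, q.2.2.1 * q.2.2.2)
  have h1 : T.card ≤ 9 * (T.image φ).card := by
    refine Finset.card_le_mul_card_image T 9 ?_
    intro p hp
    obtain ⟨q, hq, rfl⟩ := Finset.mem_image.1 hp
    refine card_quadruple_fibre_le (u := (φ q).1) (w := (φ q).2) (hT q hq).2.2.1 _ ?_
    intro r hr
    rw [Finset.mem_filter] at hr
    exact ⟨(hT r hr.1).1, congrArg Prod.fst hr.2, congrArg Prod.snd hr.2⟩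
  have h2 := card_pell_le hD hU (T.image φ) (by
    intro p hp
    obtain ⟨⟨a, b, s, t⟩, hq, rfl⟩ := Finset.mem_image.1 hp
    obtain ⟨e1, e2, e3, e4⟩ := hT _ hq
    simp only at e1 e2 e3
    refine ⟨?_, e3, e4⟩
    simp only [φ]
    rw [← e2]
    linear_combination (a * s ^ 2) * e1)
  have h3 : (T.card : ℝ) ≤ 9 * ((T.image φ).card : ℝ) := by exact_mod_cast h1
  linarith

/-! ### Counting by coefficient vectors -/

/-- The nonzero integers of absolute value at most `K`. -/
noncomputable def nonzeroInts (K : ℝ) : Finset ℤ := (Finset.Icc (-⌊K⌋) ⌊K⌋).erase 0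

theorem mem_nonzeroInts {K : ℝ} {a : ℤ} : a ∈ nonzeroInts K ↔ a ≠ 0 ∧ |(a : ℝ)| ≤ K := by
  rw [nonzeroInts, Finset.mem_erase, Finset.mem_Icc, abs_le, neg_le, neg_le (b := (a : ℝ)),
    Int.le_floor, Int.le_floor]
  push_cast
  rfl

theorem card_Icc_floor_le {x : ℝ} (hx : 1 ≤ x) :
    ((Finset.Icc (-⌊x⌋) ⌊x⌋).card : ℝ) ≤ 3 * x := by
  have h0 : 0 ≤ ⌊x⌋ := Int.floor_nonneg.2 (by linarith)
  have h1 : ((Finset.Icc (-⌊x⌋) ⌊x⌋).card : ℤ) = 2 * ⌊x⌋ + 1 := by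
    rw [Int.card_Icc, Int.toNat_of_nonneg (by omega)]
    ring
  have h2 : ((Finset.Icc (-⌊x⌋) ⌊x⌋).card : ℝ) = 2 * ⌊x⌋ + 1 := by exact_mod_cast h1
  rw [h2]
  linarith [Int.floor_le x]

/-- If the elements of `S` are determined by an index `q` in `Q` and two integer vectors of length
`l` with `|a q| x i ^ 2 ≤ K` and `|b q| y i ^ 2 ≤ K`, then their number is controlled by a sum over
`Q`. -/
theorem ncard_le_sum_of_injOn {α ι : Type*} (S : Set α) (Q : Finset ι) (a b : ι → ℤ) {K : ℝ} (l : ℕ)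
    (ha : ∀ q ∈ Q, a q ∈ nonzeroInts K) (hb : ∀ q ∈ Q, b q ∈ nonzeroInts K)
    (F : α → ι × (Fin l → ℤ) × (Fin l → ℤ)) (hF : Set.InjOn F S) (hQ : ∀ f ∈ S, (F f).1 ∈ Q)
    (hx : ∀ f ∈ S, ∀ i, |(a (F f).1 : ℝ)| * ((F f).2.1 i : ℝ) ^ 2 ≤ K)
    (hy : ∀ f ∈ S, ∀ i, |(b (F f).1 : ℝ)| * ((F f).2.2 i : ℝ) ^ 2 ≤ K) :
    (S.ncard : ℝ) ≤
      (9 * K) ^ l * ∑ q ∈ Q, (√((a q).natAbs : ℝ) ^ l)⁻¹ * (√((b q).natAbs : ℝ) ^ l)⁻¹ := by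
  classical
  let r : ℤ → ℝ := fun c => √(K / |(c : ℝ)|)
  let V : ℤ → Finset (Fin l → ℤ) := fun c => Fintype.piFinset fun _ => Finset.Icc (-⌊r c⌋) ⌊r c⌋
  have hmem : ∀ (c : ℤ) (x : Fin l → ℤ), c ∈ nonzeroInts K →
      (∀ i, |(c : ℝ)| * (x i : ℝ) ^ 2 ≤ K) → x ∈ V c := by
    intro c x hc h
    rw [Fintype.mem_piFinset]
    intro i
    have hc0 : 0 < |(c : ℝ)| := abs_pos.2 (by exact_mod_cast (mem_nonzeroInts.1 hc).1)
    have h1 : |(x i : ℝ)| ≤ r c := by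
      refine Real.le_sqrt_of_sq_le ?_
      rw [sq_abs, le_div_iff₀ hc0, mul_comm]
      exact h i
    rw [abs_le] at h1
    rw [Finset.mem_Icc, neg_le, Int.le_floor, Int.le_floor]
    push_cast
    exact ⟨by linarith, h1.2⟩
  have hV : ∀ c ∈ nonzeroInts K,
      ((V c).card : ℝ) ≤ (3 * √K) ^ l * (√(c.natAbs : ℝ) ^ l)⁻¹ := by
    intro c hc
    obtain ⟨hc0, hcK⟩ := mem_nonzeroInts.1 hc
    have hc1 : 0 < |(c : ℝ)| := abs_pos.2 (by exact_mod_cast hc0)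
    -- As |c| ≤ K, the box has radius r ≥ 1 and at most 3r integers per coordinate. The two vectors
    -- together give the factor 9K.
    have hr : 1 ≤ r c := Real.one_le_sqrt.2 ((one_le_div hc1).2 hcK)
    rw [Fintype.card_piFinset_const, Nat.cast_pow, ← inv_pow, ← mul_pow]
    refine pow_le_pow_left₀ (Nat.cast_nonneg _) ((card_Icc_floor_le hr).trans (le_of_eq ?_)) l
    simp only [r]
    rw [Real.sqrt_div (hc1.le.trans hcK), Nat.cast_natAbs, Int.cast_abs, mul_assoc, div_eq_mul_inv]
  let T : Finset (Σ _ : ι, (Fin l → ℤ) × (Fin l → ℤ)) := Q.sigma fun q => V (a q) ×ˢ V (b q)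
  have hcard : S.ncard ≤ T.card := by
    rw [← Set.ncard_coe_finset]
    refine Set.ncard_le_ncard_of_injOn (fun f => ⟨(F f).1, (F f).2⟩) ?_ ?_ T.finite_toSet
    · intro f hf
      rw [Finset.mem_coe, Finset.mem_sigma, Finset.mem_product]
      exact ⟨hQ f hf, hmem _ _ (ha _ (hQ f hf)) (hx f hf), hmem _ _ (hb _ (hQ f hf)) (hy f hf)⟩
    · intro f hf g hg hfg
      rw [Sigma.mk.injEq, heq_eq_eq] at hfg
      exact hF hf hg (Prod.ext hfg.1 hfg.2)
  calc (S.ncard : ℝ) ≤ T.card := by exact_mod_cast hcard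
    _ = ∑ q ∈ Q, ((V (a q)).card : ℝ) * ((V (b q)).card : ℝ) := by
        rw [Finset.card_sigma]
        push_cast
        simp only [Finset.card_product, Nat.cast_mul]
    _ ≤ ∑ q ∈ Q, ((3 * √K) ^ l * (√((a q).natAbs : ℝ) ^ l)⁻¹) *
          ((3 * √K) ^ l * (√((b q).natAbs : ℝ) ^ l)⁻¹) := by
        refine Finset.sum_le_sum fun q hq => ?_
        exact mul_le_mul (hV _ (ha q hq)) (hV _ (hb q hq)) (Nat.cast_nonneg _) (by positivity)
    _ = _ := by
        rw [Finset.mul_sum]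
        refine Finset.sum_congr rfl fun q hq => ?_
        have hK : 0 ≤ K := (abs_nonneg _).trans (mem_nonzeroInts.1 (ha q hq)).2
        have h9 : (9 * K) ^ l = (3 * √K) ^ l * (3 * √K) ^ l := by
          rw [← mul_pow]
          congr 1
          linear_combination -9 * Real.mul_self_sqrt hK
        rw [h9]
        ring

/-- The formal degree is odd, so j ↔ 2k+1-j has no fixed point and the top k+1 coefficients
determine the rest. The cases e = 1 and e = -1 cover A and B. -/
theorem eq_of_reflect_eq {k : ℕ} {e : ℤ} {A A' : ℤ[X]} (hA : A.natDegree ≤ 2 * k + 1)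
    (hA' : A'.natDegree ≤ 2 * k + 1) (rA : reflect (2 * k + 1) A = C e * A)
    (rA' : reflect (2 * k + 1) A' = C e * A')
    (h : ∀ i : Fin (k + 1), A.coeff (2 * k + 1 - i) = A'.coeff (2 * k + 1 - i)) (he : e ≠ 0) :
    A = A' := by
  ext j
  rcases le_or_gt j (2 * k + 1) with hj | hj
  · rcases le_or_gt (k + 1) j with hkj | hkj
    · have := h ⟨2 * k + 1 - j, by omega⟩
      simp only at this
      rwa [show 2 * k + 1 - (2 * k + 1 - j) = j by omega] at this
    · have h1 := congrArg (fun p => p.coeff j) rA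
      have h2 := congrArg (fun p => p.coeff j) rA'
      simp only [coeff_reflect, revAt_le hj, coeff_C_mul] at h1 h2
      have h3 := h ⟨j, hkj⟩
      simp only at h3
      rw [h1, h2] at h3
      exact mul_left_cancel₀ he h3
  · rw [coeff_eq_zero_of_natDegree_lt (by omega), coeff_eq_zero_of_natDegree_lt (by omega)]

theorem mem_nonzeroInts_of_coeff_sq_le {a : ℤ} {A : ℤ[X]} {K : ℝ} (ha : a ≠ 0) (hA : A ≠ 0)
    (h : ∀ i, |(a : ℝ)| * (A.coeff i : ℝ) ^ 2 ≤ K) : a ∈ nonzeroInts K := by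
  refine mem_nonzeroInts.2 ⟨ha, le_trans ?_ (h A.natDegree)⟩
  have h1 : (1 : ℤ) ≤ A.coeff A.natDegree ^ 2 :=
    Int.add_one_le_iff.2 (sq_pos_of_ne_zero (leadingCoeff_ne_zero.2 hA))
  have h2 : (1 : ℝ) ≤ (A.coeff A.natDegree : ℝ) ^ 2 := by exact_mod_cast h1
  nlinarith [abs_nonneg (a : ℝ)]

theorem IsDecomposition.eq_of_eq {k : ℕ} {f f' : ℤ[X]} {a b : ℤ} {A B A' B' : ℤ[X]}
    (h : IsDecomposition (2 * k + 1) f a b A B) (h' : IsDecomposition (2 * k + 1) f' a b A' B')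
    (hA : ∀ i : Fin (k + 1), A.coeff (2 * k + 1 - i) = A'.coeff (2 * k + 1 - i))
    (hB : ∀ i : Fin (k + 1), B.coeff (2 * k + 1 - i) = B'.coeff (2 * k + 1 - i)) : f = f' := by
  obtain rfl : A = A' := eq_of_reflect_eq (e := 1) h.natDegree_A_le h'.natDegree_A_le
    (by rw [h.reflect_A, C_1, one_mul]) (by rw [h'.reflect_A, C_1, one_mul]) hA one_ne_zero
  obtain rfl : B = B' := eq_of_reflect_eq (e := -1) h.natDegree_B_le h'.natDegree_B_le
    (by rw [h.reflect_B, C_neg, C_1, neg_one_mul]) (by rw [h'.reflect_B, C_neg, C_1, neg_one_mul])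
    hB (by norm_num)
  have h4 : (4 : ℤ[X]) ≠ 0 := by norm_num
  exact mul_left_cancel₀ h4 (h.eq.trans h'.eq.symm)

/-- The quadruples `(a, b, s, t)` with `a s² - b t² = 4` in the box given by `K`. -/
noncomputable def quadruples (K : ℝ) : Finset (ℤ × ℤ × ℤ × ℤ) :=
  (nonzeroInts K ×ˢ nonzeroInts K ×ˢ Finset.Icc (-⌊K⌋) ⌊K⌋ ×ˢ Finset.Icc (-⌊K⌋) ⌊K⌋).filter
    fun q => q.1 * q.2.2.1 ^ 2 - q.2.1 * q.2.2.2 ^ 2 = 4 ∧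
      |(q.1 : ℝ)| * (q.2.2.1 : ℝ) ^ 2 ≤ K

theorem mem_Icc_floor_of_mul_sq_le {a s : ℤ} {K : ℝ} (ha : a ≠ 0)
    (h : |(a : ℝ)| * (s : ℝ) ^ 2 ≤ K) : s ∈ Finset.Icc (-⌊K⌋) ⌊K⌋ := by
  have h1 : |s| ≤ |a| * s ^ 2 := by
    rw [← sq_abs s]
    have := abs_pos.2 ha
    rcases (abs_nonneg s).eq_or_lt with h0 | h0
    · rw [← h0]; simp
    · nlinarith [mul_pos this h0]
  have h2 : ((|s| : ℤ) : ℝ) ≤ K := by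
    refine le_trans ?_ h
    exact_mod_cast h1
  rw [Finset.mem_Icc, ← abs_le]
  exact Int.le_floor.2 h2

/-- In general the index is (a, b), with k+1 free coefficients for each of A and B. For monic f the
two leading coefficients move into the index, where they are tied by as² - bt² = 4, and k free
coefficients remain for each. -/
theorem exists_count_le (k : ℕ) : ∃ c : ℝ, 1 ≤ c ∧ ∀ H : ℝ,
    ((countE (G3 (2 * k + 1)) H : ℝ) ≤ (9 * (c * H)) ^ (k + 1) *
      (∑ a ∈ nonzeroInts (c * H), (√(a.natAbs : ℝ) ^ (k + 1))⁻¹) ^ 2) ∧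
    ((countEMonic (G3 (2 * k + 1)) H : ℝ) ≤ (9 * (c * H)) ^ k *
      ∑ q ∈ quadruples (c * H), (√(q.1.natAbs : ℝ) ^ k)⁻¹ * (√(q.2.1.natAbs : ℝ) ^ k)⁻¹) := by
  obtain ⟨c, hc1, hc⟩ := exists_coeff_sq_le (2 * k + 1)
  refine ⟨c, hc1, fun H => ?_⟩
  -- Zero serves as a default outside the exceptional set, so that one decomposition can be chosen
  -- for every f.
  have hex : ∀ f : ℤ[X], ∃ (a b : ℤ) (A B : ℤ[X]), f ∈ exceptionalSet (G3 (2 * k + 1)) H →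
      IsDecomposition (2 * k + 1) f a b A B := by
    intro f
    by_cases hf : f ∈ exceptionalSet (G3 (2 * k + 1)) H
    · obtain ⟨a, b, A, B, h⟩ := exists_isDecomposition (by omega) hf.1 hf.2.2.1 hf.2.2.2.2.2
      exact ⟨a, b, A, B, fun _ => h⟩
    · exact ⟨0, 0, 0, 0, fun h => absurd h hf⟩
  choose a b A B hdec using hex
  have hbd : ∀ f ∈ exceptionalSet (G3 (2 * k + 1)) H, ∀ i,
      |(a f : ℝ)| * ((A f).coeff i : ℝ) ^ 2 ≤ c * H ∧
        |(b f : ℝ)| * ((B f).coeff i : ℝ) ^ 2 ≤ c * H := fun f hf =>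
    hc H f _ _ _ _ hf.1 hf.2.2.2.1 (hdec f hf)
  have haI : ∀ f ∈ exceptionalSet (G3 (2 * k + 1)) H, a f ∈ nonzeroInts (c * H) := fun f hf =>
    mem_nonzeroInts_of_coeff_sq_le (hdec f hf).a_ne_zero (hdec f hf).A_ne_zero
      fun i => (hbd f hf i).1
  have hbI : ∀ f ∈ exceptionalSet (G3 (2 * k + 1)) H, b f ∈ nonzeroInts (c * H) := fun f hf =>
    mem_nonzeroInts_of_coeff_sq_le (hdec f hf).b_ne_zero (hdec f hf).B_ne_zero
      fun i => (hbd f hf i).2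
  constructor
  · have h := ncard_le_sum_of_injOn (exceptionalSet (G3 (2 * k + 1)) H)
      (nonzeroInts (c * H) ×ˢ nonzeroInts (c * H)) Prod.fst Prod.snd (K := c * H) (k + 1)
      (fun q hq => (Finset.mem_product.1 hq).1) (fun q hq => (Finset.mem_product.1 hq).2)
      (fun f => ((a f, b f), fun i => (A f).coeff (2 * k + 1 - i),
        fun i => (B f).coeff (2 * k + 1 - i)))
      (by
        intro f hf g hg hfg
        simp only [Prod.mk.injEq] at hfg
        obtain ⟨⟨h1, h2⟩, h3, h4⟩ := hfg
        have hg' := hdec g hg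
        rw [← h1, ← h2] at hg'
        exact (hdec f hf).eq_of_eq hg' (congrFun h3) (congrFun h4))
      (fun f hf => Finset.mem_product.2 ⟨haI f hf, hbI f hf⟩)
      (fun f hf i => (hbd f hf _).1) (fun f hf i => (hbd f hf _).2)
    rw [sq, Finset.sum_mul_sum, ← Finset.sum_product']
    exact h
  · have h := ncard_le_sum_of_injOn {f ∈ exceptionalSet (G3 (2 * k + 1)) H | f.Monic}
      (quadruples (c * H)) (fun q => q.1) (fun q => q.2.1) (K := c * H) k
      (fun q hq => (Finset.mem_product.1 (Finset.mem_filter.1 hq).1).1)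
      (fun q hq => (Finset.mem_product.1 (Finset.mem_product.1 (Finset.mem_filter.1 hq).1).2).1)
      -- The shift `i + 1` skips the leading coefficient, already recorded in the quadruple.
      (fun f => ((a f, b f, (A f).coeff (2 * k + 1), (B f).coeff (2 * k + 1)),
        fun i => (A f).coeff (2 * k + 1 - (i + 1)),
        fun i => (B f).coeff (2 * k + 1 - (i + 1))))
      (by
        rintro f ⟨hf, -⟩ g ⟨hg, -⟩ hfg
        simp only [Prod.mk.injEq] at hfg
        obtain ⟨⟨h1, h2, h5, h6⟩, h3, h4⟩ := hfg
        have hg' := hdec g hg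
        rw [← h1, ← h2] at hg'
        refine (hdec f hf).eq_of_eq hg' (fun i => ?_) (fun i => ?_)
        · refine Fin.cases ?_ (fun j => ?_) i
          · exact h5
          · exact congrFun h3 j
        · refine Fin.cases ?_ (fun j => ?_) i
          · exact h6
          · exact congrFun h4 j)
      (by
        rintro f ⟨hf, hmonic⟩
        simp only [quadruples, Finset.mem_filter, Finset.mem_product]
        have hd := hdec f hf
        refine ⟨⟨haI f hf, hbI f hf, mem_Icc_floor_of_mul_sq_le hd.a_ne_zero (hbd f hf _).1,
          mem_Icc_floor_of_mul_sq_le hd.b_ne_zero (hbd f hf _).2⟩, ?_, (hbd f hf _).1⟩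
        have h1 := congrArg (fun p => p.coeff ((2 * k + 1) + (2 * k + 1))) hd.eq
        simp only [coeff_sub, coeff_C_mul, sq] at h1
        rw [coeff_mul_add_eq_of_natDegree_le hd.natDegree_A_le hd.natDegree_A_le,
          coeff_mul_add_eq_of_natDegree_le hd.natDegree_B_le hd.natDegree_B_le,
          ← C_ofNat, coeff_C_mul] at h1
        have h2 : f.coeff ((2 * k + 1) + (2 * k + 1)) = 1 := by
          rw [← two_mul, ← hf.1]
          exact hmonic
        rw [h2, mul_one] at h1
        linarith)
      (fun f hf i => (hbd f hf.1 _).1) (fun f hf i => (hbd f hf.1 _).2)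
    exact h

/-! ### Sums over the index sets -/

theorem sum_nonzeroInts_le {K : ℝ} (hK : 0 ≤ K) {g : ℕ → ℝ} (hg : ∀ d, 0 ≤ g d) :
    ∑ a ∈ nonzeroInts K, g a.natAbs ≤ 2 * ∑ d ∈ Finset.Icc 1 ⌊K⌋₊, g d := by
  have hmaps : ∀ a ∈ nonzeroInts K, a.natAbs ∈ Finset.Icc 1 ⌊K⌋₊ := by
    intro a ha
    obtain ⟨h0, h1⟩ := mem_nonzeroInts.1 ha
    rw [Finset.mem_Icc]
    refine ⟨Int.natAbs_pos.2 h0, (Nat.le_floor_iff hK).2 ?_⟩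
    rwa [Nat.cast_natAbs, Int.cast_abs]
  rw [← Finset.sum_fiberwise_of_maps_to hmaps, Finset.mul_sum]
  refine Finset.sum_le_sum fun d _ => ?_
  have hsub : (nonzeroInts K).filter (fun a => a.natAbs = d) ⊆ {(d : ℤ), -(d : ℤ)} := by
    intro a ha
    have := Int.natAbs_eq_iff.1 (Finset.mem_filter.1 ha).2
    simpa using this
  calc ∑ a ∈ nonzeroInts K with a.natAbs = d, g a.natAbs
      = ∑ a ∈ nonzeroInts K with a.natAbs = d, g d :=
        Finset.sum_congr rfl fun a ha => by rw [(Finset.mem_filter.1 ha).2]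
    _ = ((nonzeroInts K).filter (fun a => a.natAbs = d)).card * g d := by
        rw [Finset.sum_const, nsmul_eq_mul]
    _ ≤ 2 * g d := by
        refine mul_le_mul_of_nonneg_right ?_ (hg d)
        exact_mod_cast (Finset.card_le_card hsub).trans Finset.card_le_two

theorem inv_sqrt_pow_le_one (k d : ℕ) : (√(d : ℝ) ^ k)⁻¹ ≤ 1 := by
  rcases Nat.eq_zero_or_pos d with rfl | hd
  · rcases Nat.eq_zero_or_pos k with rfl | hk
    · simp
    · simp [hk.ne']
  · have h1 : (1 : ℝ) ≤ √d := Real.one_le_sqrt.2 (by exact_mod_cast hd)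
    exact inv_le_one_of_one_le₀ (one_le_pow₀ h1)

/-- If a > 0 > b, then as² and -bt² are positive integers with sum 4; the opposite signs make the
left side negative. -/
theorem quadruple_bounds_of_neg {a b s t : ℤ} (h : a * s ^ 2 - b * t ^ 2 = 4) (hs : s ≠ 0)
    (ht : t ≠ 0) (hab : a * b < 0) : (-4 ≤ a ∧ a ≤ 4) ∧ (-4 ≤ b ∧ b ≤ 4) ∧ (-4 ≤ s ∧ s ≤ 4) ∧
      (-4 ≤ t ∧ t ≤ 4) := by
  have hs2 : 0 < s ^ 2 := by positivity
  have ht2 : 0 < t ^ 2 := by positivity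
  rcases mul_neg_iff.1 hab with ⟨ha, hb⟩ | ⟨ha, hb⟩
  · have h1 : a * s ^ 2 ≤ 4 := by nlinarith
    have h2 : -b * t ^ 2 ≤ 4 := by nlinarith
    have h3 : a ≤ 4 := by nlinarith
    have h4 : -b ≤ 4 := by nlinarith
    have h5 : s ^ 2 ≤ 4 := by nlinarith
    have h6 : t ^ 2 ≤ 4 := by nlinarith
    refine ⟨⟨by omega, h3⟩, ⟨by omega, by omega⟩, ⟨?_, ?_⟩, ⟨?_, ?_⟩⟩ <;> nlinarith
  · nlinarith

theorem bounds_of_mul_sq_eq_four {b t : ℤ} (h : b * t ^ 2 = 4 ∨ b * t ^ 2 = -4) :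
    (-4 ≤ b ∧ b ≤ 4) ∧ (-2 ≤ t ∧ t ≤ 2) := by
  have ht : 0 < t ^ 2 := by
    rcases eq_or_ne t 0 with rfl | ht
    · simp at h
    · positivity
  have h1 : |b| * t ^ 2 = 4 := by
    rw [← abs_of_pos ht, ← abs_mul]
    rcases h with h | h <;> rw [h] <;> rfl
  have hb : 0 < |b| := by
    rcases (abs_nonneg b).eq_or_lt with h0 | h0
    · rw [← h0] at h1; simp at h1
    · exact h0
  have h2 : |b| ≤ 4 := by nlinarith
  have h3 : t ^ 2 ≤ 4 := by nlinarith
  exact ⟨abs_le.1 h2, by constructor <;> nlinarith⟩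

theorem of_mem_quadruples {K : ℝ} {q : ℤ × ℤ × ℤ × ℤ} (hq : q ∈ quadruples K) :
    q.1 ∈ nonzeroInts K ∧ q.2.1 ∈ nonzeroInts K ∧
      q.1 * q.2.2.1 ^ 2 - q.2.1 * q.2.2.2 ^ 2 = 4 ∧ |(q.1 : ℝ)| * (q.2.2.1 : ℝ) ^ 2 ≤ K := by
  simp only [quadruples, Finset.mem_filter, Finset.mem_product] at hq
  exact ⟨hq.1.1, hq.1.2.1, hq.2.1, hq.2.2⟩

/-- For s = 0 the equation reads bt² = -4: the pair (b, t) lies in a box of 9·5 = 45 points, while a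
is unrestricted. -/
theorem sum_quadruples_fst_zero_le {K : ℝ} {w : ℕ → ℝ} (w0 : ∀ d, 0 ≤ w d) (w1 : ∀ d, w d ≤ 1) :
    ∑ q ∈ (quadruples K).filter (fun q => q.2.2.1 = 0), w q.1.natAbs * w q.2.1.natAbs ≤
      45 * ∑ a ∈ nonzeroInts K, w a.natAbs := by
  have hsub : (quadruples K).filter (fun q => q.2.2.1 = 0) ⊆
      nonzeroInts K ×ˢ Finset.Icc (-4 : ℤ) 4 ×ˢ ({0} : Finset ℤ) ×ˢ Finset.Icc (-2 : ℤ) 2 := by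
    rintro ⟨a, b, s, t⟩ hq
    obtain ⟨hq, h0⟩ := Finset.mem_filter.1 hq
    obtain ⟨h1, -, h3, -⟩ := of_mem_quadruples hq
    simp only at h0 h1 h3
    subst h0
    have := bounds_of_mul_sq_eq_four (b := b) (t := t) (Or.inr (by linarith))
    simp only [Finset.mem_product, Finset.mem_Icc, Finset.mem_singleton]
    exact ⟨h1, this.1, trivial, this.2⟩
  calc _ ≤ ∑ q ∈ (quadruples K).filter (fun q => q.2.2.1 = 0), w q.1.natAbs :=
        Finset.sum_le_sum fun q _ => mul_le_of_le_one_right (w0 _) (w1 _)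
    _ ≤ _ := Finset.sum_le_sum_of_subset_of_nonneg hsub fun q _ _ => w0 _
    _ = ∑ a ∈ nonzeroInts K, 45 * w a.natAbs := by
        rw [Finset.sum_product]
        refine Finset.sum_congr rfl fun a _ => ?_
        change ∑ _y ∈ _, w a.natAbs = _
        rw [Finset.sum_const, Finset.card_product, Finset.card_product, Finset.card_singleton,
          Int.card_Icc, Int.card_Icc, nsmul_eq_mul, show (4 + 1 - -4 : ℤ).toNat = 9 from rfl,
          show (2 + 1 - -2 : ℤ).toNat = 5 from rfl]
        norm_num
    _ = _ := by rw [Finset.mul_sum]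

theorem sum_quadruples_snd_zero_le {K : ℝ} {w : ℕ → ℝ} (w0 : ∀ d, 0 ≤ w d) (w1 : ∀ d, w d ≤ 1) :
    ∑ q ∈ (quadruples K).filter (fun q => ¬ q.2.2.1 = 0 ∧ q.2.2.2 = 0),
      w q.1.natAbs * w q.2.1.natAbs ≤ 45 * ∑ a ∈ nonzeroInts K, w a.natAbs := by
  have hsub : (quadruples K).filter (fun q => ¬ q.2.2.1 = 0 ∧ q.2.2.2 = 0) ⊆
      Finset.Icc (-4 : ℤ) 4 ×ˢ nonzeroInts K ×ˢ Finset.Icc (-2 : ℤ) 2 ×ˢ ({0} : Finset ℤ) := by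
    rintro ⟨a, b, s, t⟩ hq
    obtain ⟨hq, -, h0⟩ := Finset.mem_filter.1 hq
    obtain ⟨-, h1, h3, -⟩ := of_mem_quadruples hq
    simp only at h0 h1 h3
    subst h0
    have := bounds_of_mul_sq_eq_four (b := a) (t := s) (Or.inl (by linarith))
    simp only [Finset.mem_product, Finset.mem_Icc, Finset.mem_singleton]
    exact ⟨this.1, h1, this.2, trivial⟩
  calc _ ≤ ∑ q ∈ (quadruples K).filter (fun q => ¬ q.2.2.1 = 0 ∧ q.2.2.2 = 0), w q.2.1.natAbs :=
        Finset.sum_le_sum fun q _ => mul_le_of_le_one_left (w0 _) (w1 _)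
    _ ≤ _ := Finset.sum_le_sum_of_subset_of_nonneg hsub fun q _ _ => w0 _
    _ = ∑ _a ∈ Finset.Icc (-4 : ℤ) 4, ∑ b ∈ nonzeroInts K, 5 * w b.natAbs := by
        rw [Finset.sum_product]
        refine Finset.sum_congr rfl fun a _ => ?_
        rw [Finset.sum_product]
        refine Finset.sum_congr rfl fun b _ => ?_
        change ∑ _y ∈ _, w b.natAbs = _
        rw [Finset.sum_const, Finset.card_product, Finset.card_singleton, Int.card_Icc,
          nsmul_eq_mul, show (2 + 1 - -2 : ℤ).toNat = 5 from rfl]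
        norm_num
    _ = _ := by
        rw [Finset.sum_const, Int.card_Icc, nsmul_eq_mul, ← Finset.mul_sum, ← mul_assoc,
          show (4 + 1 - -4 : ℤ).toNat = 9 from rfl]
        norm_num

theorem sum_quadruples_neg_le {K : ℝ} {w : ℕ → ℝ} (w0 : ∀ d, 0 ≤ w d) (w1 : ∀ d, w d ≤ 1) :
    ∑ q ∈ (quadruples K).filter
      (fun q => (¬ q.2.2.1 = 0 ∧ ¬ q.2.2.2 = 0) ∧ q.1 * q.2.1 < 0),
      w q.1.natAbs * w q.2.1.natAbs ≤ 6561 := by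
  have hsub : (quadruples K).filter
      (fun q => (¬ q.2.2.1 = 0 ∧ ¬ q.2.2.2 = 0) ∧ q.1 * q.2.1 < 0) ⊆
      Finset.Icc (-4 : ℤ) 4 ×ˢ Finset.Icc (-4 : ℤ) 4 ×ˢ Finset.Icc (-4 : ℤ) 4 ×ˢ
        Finset.Icc (-4 : ℤ) 4 := by
    rintro ⟨a, b, s, t⟩ hq
    obtain ⟨hq, ⟨h1, h2⟩, h3⟩ := Finset.mem_filter.1 hq
    simp only [Finset.mem_product, Finset.mem_Icc]
    exact quadruple_bounds_of_neg (of_mem_quadruples hq).2.2.1 h1 h2 h3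
  have hcard := Finset.card_le_card hsub
  rw [Finset.card_product, Finset.card_product, Finset.card_product, Int.card_Icc] at hcard
  have h1 := Finset.sum_le_card_nsmul ((quadruples K).filter
      (fun q => (¬ q.2.2.1 = 0 ∧ ¬ q.2.2.2 = 0) ∧ q.1 * q.2.1 < 0))
      (fun q => w q.1.natAbs * w q.2.1.natAbs) 1 fun q _ => mul_le_one₀ (w1 _) (w0 _) (w1 _)
  refine h1.trans ?_
  rw [nsmul_eq_mul, mul_one]
  exact_mod_cast hcard

/-- A multiplicative weight depends only on D = |ab|, so each D contributes its weight times the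
number of its quadruples. -/
theorem sum_quadruples_pos_le {K : ℝ} (hK : 1 ≤ K) {w : ℕ → ℝ} (w0 : ∀ d, 0 ≤ w d)
    (wmul : ∀ d e, w d * w e = w (d * e)) :
    ∑ q ∈ (quadruples K).filter
      (fun q => (¬ q.2.2.1 = 0 ∧ ¬ q.2.2.2 = 0) ∧ ¬ q.1 * q.2.1 < 0),
      w q.1.natAbs * w q.2.1.natAbs ≤ 72 * Real.log (3 * K) *
        ∑ D ∈ Finset.Icc 1 ⌊K ^ 2⌋₊, w D / Real.log (D + 1) := by
  set Q := (quadruples K).filter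
    fun q => (¬ q.2.2.1 = 0 ∧ ¬ q.2.2.2 = 0) ∧ ¬ q.1 * q.2.1 < 0 with hQ
  have hmaps : ∀ q ∈ Q, (q.1 * q.2.1).natAbs ∈ Finset.Icc 1 ⌊K ^ 2⌋₊ := by
    intro q hq
    obtain ⟨h1, h2, -⟩ := of_mem_quadruples (Finset.mem_filter.1 hq).1
    rw [mem_nonzeroInts] at h1 h2
    rw [Finset.mem_Icc]
    refine ⟨Int.natAbs_pos.2 (mul_ne_zero h1.1 h2.1), (Nat.le_floor_iff (by positivity)).2 ?_⟩
    rw [Nat.cast_natAbs, Int.cast_abs, Int.cast_mul, abs_mul, sq]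
    exact mul_le_mul h1.2 h2.2 (abs_nonneg _) (by linarith)
  rw [← Finset.sum_fiberwise_of_maps_to hmaps, Finset.mul_sum]
  refine Finset.sum_le_sum fun D hD => ?_
  have hD0 : 0 < D := (Finset.mem_Icc.1 hD).1
  -- The height 3K comes from |as² - 2| ≤ K + 2 ≤ 3K.
  have hcard := card_quadruple_le hD0 (U := 3 * K) (by linarith)
    (Q.filter fun q => (q.1 * q.2.1).natAbs = D) (by
      intro q hq
      obtain ⟨hq, hqD⟩ := Finset.mem_filter.1 hq
      obtain ⟨hq, ⟨h1, h2⟩, h3⟩ := Finset.mem_filter.1 hq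
      obtain ⟨-, -, h4, h5⟩ := of_mem_quadruples hq
      refine ⟨h4, ?_, mul_ne_zero h1 h2, ?_⟩
      · rw [← hqD, Int.natAbs_of_nonneg (not_lt.1 h3)]
      · push_cast
        refine (abs_sub _ _).trans ?_
        rw [abs_mul, abs_of_nonneg (sq_nonneg (q.2.2.1 : ℝ)), abs_two]
        linarith)
  calc ∑ q ∈ Q.filter (fun q => (q.1 * q.2.1).natAbs = D), w q.1.natAbs * w q.2.1.natAbs
      = ∑ q ∈ Q.filter (fun q => (q.1 * q.2.1).natAbs = D), w D :=
        Finset.sum_congr rfl fun q hq => by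
          rw [wmul, ← Int.natAbs_mul, (Finset.mem_filter.1 hq).2]
    _ = (Q.filter fun q => (q.1 * q.2.1).natAbs = D).card * w D := by
        rw [Finset.sum_const, nsmul_eq_mul]
    _ ≤ 72 * (Real.log (3 * K) / Real.log (D + 1)) * w D :=
        mul_le_mul_of_nonneg_right hcard (w0 D)
    _ = _ := by ring

theorem sum_quadruples_le {K : ℝ} (hK : 1 ≤ K) {w : ℕ → ℝ} (w0 : ∀ d, 0 ≤ w d)
    (w1 : ∀ d, w d ≤ 1) (wmul : ∀ d e, w d * w e = w (d * e)) :
    ∑ q ∈ quadruples K, w q.1.natAbs * w q.2.1.natAbs ≤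
      6561 + 90 * ∑ a ∈ nonzeroInts K, w a.natAbs + 72 * Real.log (3 * K) *
        ∑ D ∈ Finset.Icc 1 ⌊K ^ 2⌋₊, w D / Real.log (D + 1) := by
  have e1 := Finset.sum_filter_add_sum_filter_not (quadruples K) (fun q => q.2.2.1 = 0)
    (fun q => w q.1.natAbs * w q.2.1.natAbs)
  have e2 := Finset.sum_filter_add_sum_filter_not ((quadruples K).filter fun q => ¬ q.2.2.1 = 0)
    (fun q => q.2.2.2 = 0) (fun q => w q.1.natAbs * w q.2.1.natAbs)
  rw [Finset.filter_filter, Finset.filter_filter] at e2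
  have e3 := Finset.sum_filter_add_sum_filter_not
    ((quadruples K).filter fun q => ¬ q.2.2.1 = 0 ∧ ¬ q.2.2.2 = 0)
    (fun q => q.1 * q.2.1 < 0) (fun q => w q.1.natAbs * w q.2.1.natAbs)
  rw [Finset.filter_filter, Finset.filter_filter] at e3
  have hs := sum_quadruples_fst_zero_le (K := K) w0 w1
  have ht := sum_quadruples_snd_zero_le (K := K) w0 w1
  have hneg := sum_quadruples_neg_le (K := K) w0 w1
  have hpos := sum_quadruples_pos_le hK w0 wmul
  linarith

theorem sum_quadruples_inv_sqrt_pow_le {K : ℝ} (hK : 1 ≤ K) (k : ℕ) :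
    ∑ q ∈ quadruples K, (√(q.1.natAbs : ℝ) ^ k)⁻¹ * (√(q.2.1.natAbs : ℝ) ^ k)⁻¹ ≤
      6561 + 180 * ∑ d ∈ Finset.Icc 1 ⌊K⌋₊, (√(d : ℝ) ^ k)⁻¹ +
        72 * Real.log (3 * K) *
          ∑ D ∈ Finset.Icc 1 ⌊K ^ 2⌋₊, (√(D : ℝ) ^ k)⁻¹ / Real.log (D + 1) := by
  have h1 := sum_quadruples_le hK (w := fun d => (√(d : ℝ) ^ k)⁻¹) (fun d => by positivity)
    (inv_sqrt_pow_le_one k) (fun d e => by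
      rw [← mul_inv, ← mul_pow, Nat.cast_mul, Real.sqrt_mul (Nat.cast_nonneg _)])
  have h2 := sum_nonzeroInts_le (zero_le_one.trans hK) (g := fun d => (√(d : ℝ) ^ k)⁻¹)
    (fun d => by positivity)
  linarith

/-! ### Elementary sums -/

theorem sum_inv_le {K : ℝ} (hK : 1 ≤ K) :
    ∑ d ∈ Finset.Icc 1 ⌊K⌋₊, (√(d : ℝ) ^ 2)⁻¹ ≤ 1 + Real.log K := by
  have h := harmonic_floor_le_one_add_log K hK
  rw [harmonic_eq_sum_Icc] at h
  push_cast at h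
  simpa only [Real.sq_sqrt (Nat.cast_nonneg _)] using h

theorem sum_inv_sqrt_le (N : ℕ) : ∑ d ∈ Finset.Icc 1 N, (√(d : ℝ) ^ 1)⁻¹ ≤ 2 * √(N : ℝ) := by
  induction N with
  | zero => simp
  | succ N ih =>
    rw [Finset.sum_Icc_succ_top (by omega), pow_one]
    have h1 : 0 < √((N + 1 : ℕ) : ℝ) := Real.sqrt_pos.2 (by positivity)
    have h2 := Real.sq_sqrt (Nat.cast_nonneg (α := ℝ) N)
    have h3 := Real.sq_sqrt (Nat.cast_nonneg (α := ℝ) (N + 1))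
    have h4 : (√((N + 1 : ℕ) : ℝ))⁻¹ ≤ 2 * √((N + 1 : ℕ) : ℝ) - 2 * √(N : ℝ) := by
      rw [inv_eq_one_div, div_le_iff₀ h1]
      push_cast at h2 h3 ⊢
      nlinarith [sq_nonneg (√((N : ℝ) + 1) - √(N : ℝ))]
    linarith

theorem exists_sum_inv_sqrt_pow_le : ∃ c : ℝ, 0 < c ∧ ∀ k : ℕ, 3 ≤ k → ∀ s : Finset ℕ,
    ∑ d ∈ s, (√(d : ℝ) ^ k)⁻¹ ≤ c := by
  have hsum : Summable fun d : ℕ => (√(d : ℝ) ^ 3)⁻¹ := by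
    have := Real.summable_nat_rpow_inv.2 (show (1 : ℝ) < 3 / 2 by norm_num)
    refine this.congr fun d => ?_
    rw [Real.sqrt_eq_rpow, ← Real.rpow_natCast, ← Real.rpow_mul (Nat.cast_nonneg _)]
    norm_num
  refine ⟨1 + ∑' d : ℕ, (√(d : ℝ) ^ 3)⁻¹,
    add_pos_of_pos_of_nonneg one_pos (tsum_nonneg fun d => by positivity), fun k hk s => ?_⟩
  calc ∑ d ∈ s, (√(d : ℝ) ^ k)⁻¹ ≤ ∑ d ∈ s, (√(d : ℝ) ^ 3)⁻¹ := by
        refine Finset.sum_le_sum fun d _ => ?_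
        rcases Nat.eq_zero_or_pos d with rfl | hd
        · simp [show k ≠ 0 by omega]
        · have h1 : (1 : ℝ) ≤ √d := Real.one_le_sqrt.2 (by exact_mod_cast hd)
          exact inv_anti₀ (by positivity) (pow_le_pow_right₀ h1 hk)
    _ ≤ ∑' d : ℕ, (√(d : ℝ) ^ 3)⁻¹ := hsum.sum_le_tsum s fun d _ => by positivity
    _ ≤ _ := by linarith

theorem half_le_log_add_one {D : ℕ} (hD : 1 ≤ D) : 1 / 2 ≤ Real.log ((D : ℝ) + 1) := by
  have h1 : (2 : ℝ) ≤ (D : ℝ) + 1 := by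
    have : (1 : ℝ) ≤ D := by exact_mod_cast hD
    linarith
  have h2 := Real.log_le_log two_pos h1
  linarith [Real.log_two_gt_d9]

/-- Cut at D = K. Below, 1/log(D+1) ≤ 2 and the sum is at most 4√K, negligible even after
multiplication by log K ≤ 2√K. Above, log(D+1) ≥ log K cancels the outer logarithm and the sum of
D^(-1/2) up to K² leaves 2K. Hence no logarithm appears in the monic case n = 3. -/
theorem sum_inv_sqrt_div_log_le {K : ℝ} (hK : 3 ≤ K) :
    Real.log K * ∑ D ∈ Finset.Icc 1 ⌊K ^ 2⌋₊, (√(D : ℝ) ^ 1)⁻¹ / Real.log (D + 1) ≤ 10 * K := by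
  have hlog : 0 < Real.log K := Real.log_pos (by linarith)
  have hK0 : 0 ≤ K := by linarith
  have hsq := Real.sq_sqrt hK0
  have hlogle : Real.log K ≤ 2 * √K := by
    have h1 := Real.log_le_sub_one_of_pos (Real.sqrt_pos.2 (show 0 < K by linarith))
    rw [Real.log_sqrt hK0] at h1
    linarith
  have hterm : ∀ D ∈ Finset.Icc 1 ⌊K ^ 2⌋₊, (√(D : ℝ) ^ 1)⁻¹ / Real.log (D + 1) ≤
      (if D ≤ ⌊K⌋₊ then 2 * (√(D : ℝ) ^ 1)⁻¹ else 0) + (√(D : ℝ) ^ 1)⁻¹ / Real.log K := by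
    intro D hD
    have h1 := half_le_log_add_one (Finset.mem_Icc.1 hD).1
    have hnn : 0 ≤ (√(D : ℝ) ^ 1)⁻¹ := by positivity
    split_ifs with hDK
    · have h2 : (√(D : ℝ) ^ 1)⁻¹ / Real.log (D + 1) ≤ 2 * (√(D : ℝ) ^ 1)⁻¹ := by
        rw [div_le_iff₀ (by linarith)]
        nlinarith
      have : 0 ≤ (√(D : ℝ) ^ 1)⁻¹ / Real.log K := by positivity
      linarith
    · rw [zero_add]
      have h2 : K ≤ D + 1 := by
        have h3 : ⌊K⌋₊ + 1 ≤ D := by omega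
        have h4 : ((⌊K⌋₊ + 1 : ℕ) : ℝ) ≤ D := by exact_mod_cast h3
        push_cast at h4
        linarith [Nat.lt_floor_add_one K]
      exact div_le_div_of_nonneg_left hnn hlog (Real.log_le_log (by linarith) h2)
  have hle : ⌊K⌋₊ ≤ ⌊K ^ 2⌋₊ := Nat.floor_le_floor (by nlinarith)
  have hS1 : ∑ D ∈ Finset.Icc 1 ⌊K ^ 2⌋₊,
      (if D ≤ ⌊K⌋₊ then 2 * (√(D : ℝ) ^ 1)⁻¹ else 0) ≤ 4 * √K := by
    rw [← Finset.sum_filter]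
    have : (Finset.Icc 1 ⌊K ^ 2⌋₊).filter (fun D => D ≤ ⌊K⌋₊) = Finset.Icc 1 ⌊K⌋₊ := by
      ext D
      simp only [Finset.mem_filter, Finset.mem_Icc]
      omega
    rw [this, ← Finset.mul_sum]
    have h1 := sum_inv_sqrt_le ⌊K⌋₊
    have h2 := Real.sqrt_le_sqrt (Nat.floor_le hK0)
    linarith
  have hS2 : ∑ D ∈ Finset.Icc 1 ⌊K ^ 2⌋₊, (√(D : ℝ) ^ 1)⁻¹ / Real.log K ≤
      2 * K / Real.log K := by
    rw [← Finset.sum_div]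
    refine div_le_div_of_nonneg_right ?_ hlog.le
    have h1 := sum_inv_sqrt_le ⌊K ^ 2⌋₊
    have h2 := Real.sqrt_le_sqrt (Nat.floor_le (sq_nonneg K))
    rw [Real.sqrt_sq hK0] at h2
    linarith
  have hS := (Finset.sum_le_sum hterm).trans (Finset.sum_add_distrib.trans_le (add_le_add hS1 hS2))
  calc Real.log K * ∑ D ∈ Finset.Icc 1 ⌊K ^ 2⌋₊, (√(D : ℝ) ^ 1)⁻¹ / Real.log (D + 1)
      ≤ Real.log K * (4 * √K + 2 * K / Real.log K) := mul_le_mul_of_nonneg_left hS hlog.le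
    _ = 4 * (Real.log K * √K) + 2 * K := by field_simp
    _ ≤ 10 * K := by nlinarith [Real.sqrt_nonneg K]

/-- Each term is at most the increment of 2 log log(N+1), by log x ≥ 1 - 1/x used twice. The factor
2 absorbs 1/(N+1) ≤ 2/(N+2), and the absolute value in the constant handles log log 2 < 0 at N = 1.
-/
theorem exists_sum_inv_div_log_le : ∃ c : ℝ, 0 < c ∧ ∀ N : ℕ, 1 ≤ N →
    ∑ D ∈ Finset.Icc 1 N, (√(D : ℝ) ^ 2)⁻¹ / Real.log (D + 1) ≤
      c + 2 * Real.log (Real.log (N + 1)) := by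
  refine ⟨2 + 2 * |Real.log (Real.log 2)|, by positivity, fun N hN => ?_⟩
  induction N, hN using Nat.le_induction with
  | base =>
    have h1 := Real.log_two_gt_d9
    have h2 : (Real.log 2)⁻¹ ≤ 2 := by
      rw [inv_le_comm₀ (by linarith) two_pos]
      linarith
    simp only [Finset.Icc_self, Finset.sum_singleton, Nat.cast_one, Real.sqrt_one, one_pow,
      inv_one, one_div, one_add_one_eq_two]
    linarith [neg_abs_le (Real.log (Real.log 2))]
  | succ N hN ih =>
    rw [Finset.sum_Icc_succ_top (by omega), Real.sq_sqrt (Nat.cast_nonneg _)]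
    push_cast
    have hN0 : (1 : ℝ) ≤ N := by exact_mod_cast hN
    have hL : 0 < Real.log ((N : ℝ) + 1) := Real.log_pos (by linarith)
    have hL' : 0 < Real.log ((N : ℝ) + 1 + 1) := Real.log_pos (by linarith)
    have h1 := Real.one_sub_inv_le_log_of_pos (div_pos hL' hL)
    rw [Real.log_div hL'.ne' hL.ne', inv_div] at h1
    have h2 := Real.one_sub_inv_le_log_of_pos
      (div_pos (show (0 : ℝ) < N + 1 + 1 by linarith) (show (0 : ℝ) < N + 1 by linarith))
    rw [Real.log_div (by linarith) (by linarith), inv_div] at h2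
    have h3 : ((N : ℝ) + 1)⁻¹ / Real.log ((N : ℝ) + 1 + 1) ≤
        2 * (1 - Real.log ((N : ℝ) + 1) / Real.log ((N : ℝ) + 1 + 1)) := by
      have h4 : ((N : ℝ) + 1)⁻¹ ≤
          2 * (Real.log ((N : ℝ) + 1 + 1) - Real.log ((N : ℝ) + 1)) := by
        have h5 : ((N : ℝ) + 1)⁻¹ ≤ 2 * (1 - ((N : ℝ) + 1) / (N + 1 + 1)) := by
          rw [one_sub_div (by linarith), inv_eq_one_div, ← mul_div_assoc,
            div_le_div_iff₀ (by linarith) (by linarith)]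
          linarith
        linarith
      rw [div_le_iff₀ hL']
      refine h4.trans (le_of_eq ?_)
      field_simp
    linarith

/-! ### The five estimates -/

theorem eventually_log_bounds {c : ℝ} (hc : 1 ≤ c) : ∀ᶠ H : ℝ in atTop,
    3 ≤ H ∧ 1 ≤ Real.log H ∧ 1 ≤ Real.log (Real.log H) ∧ 3 ≤ c * H ∧
      0 < Real.log (c * H) ∧ Real.log (c * H) ≤ 2 * Real.log H ∧
      Real.log (3 * (c * H)) ≤ 2 * Real.log (c * H) := by
  filter_upwards [eventually_ge_atTop 3, eventually_ge_atTop c,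
    Real.tendsto_log_atTop.eventually_ge_atTop 1,
    (Real.tendsto_log_atTop.comp Real.tendsto_log_atTop).eventually_ge_atTop 1]
    with H h3 hcH hl hll
  have h1 : 3 ≤ c * H := by nlinarith
  refine ⟨h3, hl, hll, h1, Real.log_pos (by linarith), ?_, ?_⟩
  · rw [Real.log_mul (by linarith) (by linarith)]
    linarith [Real.log_le_log (by linarith) hcH]
  · rw [Real.log_mul (by norm_num) (by linarith)]
    linarith [Real.log_le_log (by norm_num) h1]

theorem isBigO_of_eventually_le {f g : ℝ → ℝ} {C : ℝ} (hf : ∀ H, 0 ≤ f H)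
    (h : ∀ᶠ H in atTop, 0 ≤ g H ∧ f H ≤ C * g H) : f =O[atTop] g := by
  refine IsBigO.of_bound C ?_
  filter_upwards [h] with H hH
  rw [Real.norm_of_nonneg (hf H), Real.norm_of_nonneg hH.1]
  exact hH.2

theorem countE_three_isBigO : (fun H : ℝ => (countE (G3 3) H : ℝ))
    =O[atTop] fun H : ℝ => H ^ 2 * Real.log H ^ 2 := by
  obtain ⟨c, hc, h⟩ := exists_count_le 1
  refine isBigO_of_eventually_le (C := 2916 * c ^ 2) (fun H => Nat.cast_nonneg _) ?_
  filter_upwards [eventually_log_bounds hc] with H ⟨h3, hl, hll, hcH, hlc, hlc2, hl3⟩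
  refine ⟨by positivity, ((h H).1).trans ?_⟩
  have h1 := sum_nonzeroInts_le (K := c * H) (by linarith) (g := fun d => (√(d : ℝ) ^ (1 + 1))⁻¹)
    (fun d => by positivity)
  have h2 := sum_inv_le (K := c * H) (by linarith)
  -- 2(1 + log cH) ≤ 2(1 + 2 log H) ≤ 6 log H.
  have h4 : ∑ a ∈ nonzeroInts (c * H), (√(a.natAbs : ℝ) ^ (1 + 1))⁻¹ ≤ 6 * Real.log H := by
    simp only [one_add_one_eq_two] at h1 ⊢
    linarith
  have h5 := pow_le_pow_left₀ (Finset.sum_nonneg fun a _ => by positivity) h4 2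
  calc _ ≤ (9 * (c * H)) ^ (1 + 1) * (6 * Real.log H) ^ 2 :=
        mul_le_mul_of_nonneg_left h5 (by positivity)
    _ = _ := by ring

/-- Here (k+1)/2 ≥ 3/2, so the sums over a and b stay bounded. -/
theorem countE_isBigO {k : ℕ} (hk : 2 ≤ k) : (fun H : ℝ => (countE (G3 (2 * k + 1)) H : ℝ))
    =O[atTop] fun H : ℝ => H ^ (k + 1) := by
  obtain ⟨c, hc, h⟩ := exists_count_le k
  obtain ⟨e, he, hsum⟩ := exists_sum_inv_sqrt_pow_le
  refine isBigO_of_eventually_le (C := (9 * c) ^ (k + 1) * (2 * e) ^ 2)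
    (fun H => Nat.cast_nonneg _) ?_
  filter_upwards [eventually_ge_atTop 0] with H h0
  refine ⟨by positivity, ((h H).1).trans ?_⟩
  have h1 := sum_nonzeroInts_le (K := c * H) (by positivity)
    (g := fun d => (√(d : ℝ) ^ (k + 1))⁻¹) (fun d => by positivity)
  have h4 := h1.trans (mul_le_mul_of_nonneg_left
    (hsum (k + 1) (by omega) (Finset.Icc 1 ⌊c * H⌋₊)) two_pos.le)
  have h5 := pow_le_pow_left₀ (Finset.sum_nonneg fun a _ => by positivity) h4 2
  calc _ ≤ (9 * (c * H)) ^ (k + 1) * (2 * e) ^ 2 :=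
        mul_le_mul_of_nonneg_left h5 (by positivity)
    _ = _ := by rw [← mul_assoc, mul_pow (9 * c)]; ring

theorem countEMonic_three_isBigO : (fun H : ℝ => (countEMonic (G3 3) H : ℝ))
    =O[atTop] fun H : ℝ => H ^ 2 := by
  obtain ⟨c, hc, h⟩ := exists_count_le 1
  refine isBigO_of_eventually_le (C := 75249 * c ^ 2) (fun H => Nat.cast_nonneg _) ?_
  filter_upwards [eventually_log_bounds hc] with H ⟨h3, hl, hll, hcH, hlc, hlc2, hl3⟩
  refine ⟨by positivity, ((h H).2).trans ?_⟩
  have h1 := sum_quadruples_inv_sqrt_pow_le (K := c * H) (by linarith) 1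
  have h2 := sum_inv_sqrt_le ⌊c * H⌋₊
  have h2' : √(⌊c * H⌋₊ : ℝ) ≤ c * H :=
    (Real.sqrt_le_sqrt (Nat.floor_le (by linarith))).trans
      ((Real.sqrt_le_left (by linarith)).2 (by nlinarith))
  have h4 := sum_inv_sqrt_div_log_le hcH
  set S := ∑ D ∈ Finset.Icc 1 ⌊(c * H) ^ 2⌋₊, (√(D : ℝ) ^ 1)⁻¹ / Real.log (D + 1) with hS
  have hS0 : 0 ≤ S := Finset.sum_nonneg fun D hD =>
    div_nonneg (by positivity) (by linarith [half_le_log_add_one (Finset.mem_Icc.1 hD).1])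
  have h5 : Real.log (3 * (c * H)) * S ≤ 20 * (c * H) := by nlinarith
  -- 8361 = 6561 + 180·2 + 72·20, one summand for each term of `h1`.
  calc _ ≤ (9 * (c * H)) ^ 1 * (8361 * (c * H)) := by
        refine mul_le_mul_of_nonneg_left (h1.trans ?_) (by positivity)
        nlinarith
    _ = _ := by ring

theorem countEMonic_five_isBigO : (fun H : ℝ => (countEMonic (G3 5) H : ℝ))
    =O[atTop] fun H : ℝ => H ^ 2 * Real.log H * Real.log (Real.log H) := by
  obtain ⟨c, hc, h⟩ := exists_count_le 2
  obtain ⟨e, he, hsum⟩ := exists_sum_inv_div_log_le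
  -- 540 = 180·3 from 1 + log cH ≤ 3 log H, 288 = 72·4 from log(3cH) ≤ 4 log H, and 8 = 2·4 from the
  -- double logarithm at (cH)².
  refine isBigO_of_eventually_le (C := 81 * c ^ 2 * (6561 + 540 + 288 * (e + 8)))
    (fun H => Nat.cast_nonneg _) ?_
  filter_upwards [eventually_log_bounds hc] with H ⟨h3, hl, hll, hcH, hlc, hlc2, hl3⟩
  refine ⟨by positivity, ((h H).2).trans ?_⟩
  have h1 := sum_quadruples_inv_sqrt_pow_le (K := c * H) (by linarith) 2
  have h2 := sum_inv_le (K := c * H) (by linarith)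
  have hN : 1 ≤ ⌊(c * H) ^ 2⌋₊ := (Nat.one_le_floor_iff _).2 (by nlinarith)
  have h4 := hsum _ hN
  set S := ∑ D ∈ Finset.Icc 1 ⌊(c * H) ^ 2⌋₊, (√(D : ℝ) ^ 2)⁻¹ / Real.log (D + 1) with hS
  have hS0 : 0 ≤ S := Finset.sum_nonneg fun D hD =>
    div_nonneg (by positivity) (by linarith [half_le_log_add_one (Finset.mem_Icc.1 hD).1])
  have hN1 : (1 : ℝ) ≤ (⌊(c * H) ^ 2⌋₊ : ℝ) := by exact_mod_cast hN
  have h5 : Real.log (Real.log ((⌊(c * H) ^ 2⌋₊ : ℝ) + 1)) ≤ 4 * Real.log (Real.log H) := by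
    have h6 : Real.log ((⌊(c * H) ^ 2⌋₊ : ℝ) + 1) ≤ 6 * Real.log H := by
      have h7 : (⌊(c * H) ^ 2⌋₊ : ℝ) + 1 ≤ (c * H) ^ 3 := by
        have := Nat.floor_le (sq_nonneg (c * H))
        nlinarith [sq_nonneg (c * H)]
      have h8 := Real.log_le_log (by linarith) h7
      rw [Real.log_pow] at h8
      push_cast at h8
      linarith
    have h9 := Real.log_le_log (Real.log_pos (by linarith)) h6
    rw [Real.log_mul (by norm_num) (by linarith)] at h9
    have h10 : Real.log 6 ≤ 3 := by
      rw [Real.log_le_iff_le_exp (by norm_num)]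
      have h11 := Real.add_one_le_exp (1 : ℝ)
      have h12 : Real.exp 3 = Real.exp 1 ^ 3 := by rw [← Real.exp_nat_mul]; norm_num
      rw [h12]
      nlinarith [pow_le_pow_left₀ (by norm_num : (0 : ℝ) ≤ 1 + 1) h11 3]
    linarith
  have hS1 : S ≤ (e + 8) * Real.log (Real.log H) := by nlinarith
  have h6 : Real.log (3 * (c * H)) * S ≤
      4 * Real.log H * ((e + 8) * Real.log (Real.log H)) :=
    mul_le_mul (by linarith) hS1 hS0 (by linarith)
  have h7 : Real.log H ≤ Real.log H * Real.log (Real.log H) := by nlinarith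
  calc _ ≤ (9 * (c * H)) ^ 2 *
        ((6561 + 540 + 288 * (e + 8)) * (Real.log H * Real.log (Real.log H))) := by
        refine mul_le_mul_of_nonneg_left (h1.trans ?_) (by positivity)
        nlinarith
    _ = _ := by ring

/-- For k ≥ 3 both sums converge, since k/2 > 1 and log(D+1) ≥ 1/2. The only growth beyond H^k is
the logarithm of the Pell count. -/
theorem countEMonic_isBigO {k : ℕ} (hk : 3 ≤ k) :
    (fun H : ℝ => (countEMonic (G3 (2 * k + 1)) H : ℝ))
      =O[atTop] fun H : ℝ => H ^ k * Real.log H := by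
  obtain ⟨c, hc, h⟩ := exists_count_le k
  obtain ⟨e, he, hsum⟩ := exists_sum_inv_sqrt_pow_le
  refine isBigO_of_eventually_le (C := (9 * c) ^ k * (6561 + 180 * e + 576 * e))
    (fun H => Nat.cast_nonneg _) ?_
  filter_upwards [eventually_log_bounds hc] with H ⟨h3, hl, hll, hcH, hlc, hlc2, hl3⟩
  refine ⟨by positivity, ((h H).2).trans ?_⟩
  have h1 := sum_quadruples_inv_sqrt_pow_le (K := c * H) (by linarith) k
  have h2 := hsum k hk (Finset.Icc 1 ⌊c * H⌋₊)
  have h4 : ∑ D ∈ Finset.Icc 1 ⌊(c * H) ^ 2⌋₊, (√(D : ℝ) ^ k)⁻¹ / Real.log (D + 1) ≤ 2 * e := by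
    have h5 : ∀ D ∈ Finset.Icc 1 ⌊(c * H) ^ 2⌋₊, (√(D : ℝ) ^ k)⁻¹ / Real.log (D + 1) ≤
        2 * (√(D : ℝ) ^ k)⁻¹ := by
      intro D hD
      have h6 := half_le_log_add_one (Finset.mem_Icc.1 hD).1
      have hnn : 0 ≤ (√(D : ℝ) ^ k)⁻¹ := by positivity
      rw [div_le_iff₀ (by linarith)]
      nlinarith
    refine (Finset.sum_le_sum h5).trans ?_
    rw [← Finset.mul_sum]
    linarith [hsum k hk (Finset.Icc 1 ⌊(c * H) ^ 2⌋₊)]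
  have h5 : Real.log (3 * (c * H)) * ∑ D ∈ Finset.Icc 1 ⌊(c * H) ^ 2⌋₊,
      (√(D : ℝ) ^ k)⁻¹ / Real.log (D + 1) ≤ 4 * Real.log H * (2 * e) :=
    mul_le_mul (by linarith) h4 (Finset.sum_nonneg fun D hD =>
      div_nonneg (by positivity) (by linarith [half_le_log_add_one (Finset.mem_Icc.1 hD).1]))
      (by linarith)
  calc _ ≤ (9 * (c * H)) ^ k * ((6561 + 180 * e + 576 * e) * Real.log H) := by
        refine mul_le_mul_of_nonneg_left (h1.trans ?_) (by positivity)
        nlinarith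
    _ = _ := by rw [← mul_assoc 9, mul_pow (9 * c)]; ring

end ReciprocalGalois

/-- Since `n` is odd, the exponents `(n + 1) / 2` and `(n - 1) / 2` are exact divisions. -/
theorem mainTheorem7 (n : ℕ) (hn : 3 ≤ n) (hodd : Odd n) :
    ((n = 3 →
        (fun H : ℝ => (ReciprocalGalois.countE (ReciprocalGalois.G3 n) H : ℝ))
          =O[atTop] fun H : ℝ => H ^ 2 * Real.log H ^ 2) ∧
      (5 ≤ n →
        (fun H : ℝ => (ReciprocalGalois.countE (ReciprocalGalois.G3 n) H : ℝ))
          =O[atTop] fun H : ℝ => H ^ ((n + 1) / 2))) ∧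
    ((n = 3 →
        (fun H : ℝ => (ReciprocalGalois.countEMonic (ReciprocalGalois.G3 n) H : ℝ))
          =O[atTop] fun H : ℝ => H ^ 2) ∧
      (n = 5 →
        (fun H : ℝ => (ReciprocalGalois.countEMonic (ReciprocalGalois.G3 n) H : ℝ))
          =O[atTop] fun H : ℝ => H ^ 2 * Real.log H * Real.log (Real.log H)) ∧
      (7 ≤ n →
        (fun H : ℝ => (ReciprocalGalois.countEMonic (ReciprocalGalois.G3 n) H : ℝ))
          =O[atTop] fun H : ℝ => H ^ ((n - 1) / 2) * Real.log H)) := by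
  obtain ⟨k, rfl⟩ := hodd
  have e1 : (2 * k + 1 + 1) / 2 = k + 1 := by omega
  have e2 : (2 * k + 1 - 1) / 2 = k := by omega
  rw [e1, e2]
  refine ⟨⟨fun h => ?_, fun h => ReciprocalGalois.countE_isBigO (by omega)⟩, fun h => ?_,
    fun h => ?_, fun h => ReciprocalGalois.countEMonic_isBigO (by omega)⟩
  · obtain rfl : k = 1 := by omega
    exact ReciprocalGalois.countE_three_isBigO
  · obtain rfl : k = 1 := by omega
    exact ReciprocalGalois.countEMonic_three_isBigO
  · obtain rfl : k = 2 := by omega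
    exact ReciprocalGalois.countEMonic_five_isBigO
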